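/- Let $p$ be a prime and $K=\mathbb{Q}_p$. For $a,b\in K^\times$ let $(a,b)\in\{\pm1\}$ be the Hilbert symbol, equal to $1$ exactly when $ax^2+by^2-z^2$ is isotropic over $K$; it depends only on the classes of $a,b$ in $K^\times/(K^\times)^2$. Let $(V,Q)$ be a nondegenerate finite-dimensional quadratic space over $K$. The standard invariants of $(V,Q)$ are $(n,d,c)$, where, for an orthogonal basis in which $Q=a_1x_1^2+\cdots+a_nx_n^2$, one puts $n=\dim V$, $d=\prod_i a_i\in K^\times/(K^\times)^2$ and $c=\prod_{i<j}(a_i,a_j)$. Let $\mathbb{H}$ be the hyperbolic plane $xy$. The invariants $(n,\delta,w)\in\mathbb{Z}_{\ge0}\times K^\times/(K^\times)^2\times\{\pm1\}$ of Gan, Hanke and Yu are read off from the form of the space, up to isometry: 1. $\mathbb{H}^r$ ($r\ge 0$): $n=2r$, $\delta=1$, $w=1$. 2. $\mathbb{H}^{r-2}\oplus D$ ($r\ge 2$), $D=x^2-ay^2-bz^2+abt^2$ the norm form of a quaternion division algebra: $n=2r$, $\delta=1$, $w=-1$. 3. $\mathbb{H}^{r-1}\oplus\alpha(x^2-\delta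 y^2)$ ($r\ge 1$, $\delta$ not a square): $n=2r$, the class of $\delta$, and $w=(\alpha,-\alpha\delta)$, the Hasse invariant of the anisotropic part. 4. $\mathbb{H}^r\oplus\delta x^2$ ($r\ge 0$): $n=2r+1$, the class of $\delta$, $w=1$. 5. $\mathbb{H}^{r-1}\oplus-\delta(ax^2+by^2+abz^2)$ ($r\ge 1$, the ternary form anisotropic): $n=2r+1$, the class of $\delta$, $w=-1$. Then every nondegenerate quadratic space over $K$ has exactly one triple $(n,\delta,w)$ and exactly one triple $(n,d,c)$. With $r=\lfloor n/2\rfloor$, the second is obtained from the first by $d=(-1)^r\delta$ and by the value of $c$ in the following table, which also gives the dimension $m$ of the anisotropic part (well defined: any decomposition of the space into hyperbolic planes and an anisotropic space has anisotropic part of this dimension): | $n$ | $\delta$ | $w$ | $m$ | $c$ | |---|---|---|---|---| | $2r$ | $1$ | $1$ | $0$ | $(-1,-1)^{\lfloor r/2\rfloor}$ | | $2r$ | $1$ | $-1$ | $4$ | $-(-1,-1)^{\lfloor r/2\rfloor}$ | | $2r$ | $\ne1$ | $w$ | $2$ | $(-1,-1)^{\lfloor (r-1)/2\rfloor}\cdot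 w\cdot((-1)^{r-1},-\delta)$ | | $2r+1$ | $\delta$ | $1$ | $1$ | $(-1,-1)^{\lfloor r/2\rfloor}\cdot((-1)^r,\delta)$ | | $2r+1$ | $\delta$ | $-1$ | $3$ | $-(-1,-1)^{\lfloor (r-1)/2\rfloor}\cdot((-1)^{r-1},-\delta)\cdot(-1,\delta)$ | The resulting map $(n,\delta,w)\mapsto(n,d,c)$ is a bijection from the set of triples $(n,\delta,w)$ of nondegenerate quadratic spaces over $K$ onto the set of triples $(n,d,c)$ of nondegenerate quadratic spaces over $K$. -/

import Mathlib

universe u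

noncomputable section

namespace LocalQuadratic

open scoped BigOperators

/-- The group `Kˣ / (Kˣ)²` of squareclasses of a field. -/
abbrev SquareClass (K : Type*) [Field K] : Type _ := Kˣ ⧸ Subgroup.square Kˣ

section Hilbert

variable {K : Type*} [Field K]

/-- The squareclass of a nonzero element. -/
def sqClass (a : Kˣ) : SquareClass K := QuotientGroup.mk a

/-- `a x² + b y² - z²` has a nontrivial zero. -/
def HilbertSolvable (a b : Kˣ) : Prop :=
  ∃ x y z : K, (x ≠ 0 ∨ y ≠ 0 ∨ z ≠ 0) ∧ (a : K) * x ^ 2 + (b : K) * y ^ 2 - z ^ 2 = 0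

open Classical in
/-- The Hilbert symbol `(a, b)`: it is `1` if `a x² + b y² - z²` is isotropic, and `-1` if not. -/
def hilbertSymbol (a b : Kˣ) : ℤˣ := if HilbertSolvable a b then 1 else -1

lemma HilbertSolvable.of_mul_sq {a b : Kˣ} (s t : Kˣ)
    (h : HilbertSolvable (a * (s * s)) (b * (t * t))) : HilbertSolvable a b := by
  obtain ⟨x, y, z, hne, h⟩ := h
  refine ⟨s * x, t * y, z, ?_, ?_⟩
  · simpa using hne
  · rw [← h]; push_cast; ring

lemma hilbertSolvable_mul_sq (a b s t : Kˣ) :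
    HilbertSolvable (a * (s * s)) (b * (t * t)) ↔ HilbertSolvable a b := by
  refine ⟨fun h => h.of_mul_sq s t, fun h => ?_⟩
  refine HilbertSolvable.of_mul_sq s⁻¹ t⁻¹ ?_
  have e : ∀ c u : Kˣ, c * (u * u) * (u⁻¹ * u⁻¹) = c := fun c u => by
    rw [mul_assoc, mul_mul_mul_comm]; simp
  rwa [e, e]

lemma hilbertSymbol_mul_sq (a b s t : Kˣ) :
    hilbertSymbol (a * (s * s)) (b * (t * t)) = hilbertSymbol a b := by
  unfold hilbertSymbol
  by_cases h : HilbertSolvable a b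
  · rw [if_pos h, if_pos ((hilbertSolvable_mul_sq a b s t).mpr h)]
  · rw [if_neg h, if_neg fun h' => h ((hilbertSolvable_mul_sq a b s t).mp h')]

/-- The Hilbert symbol as a function of two squareclasses. -/
def hilbertClass (a b : SquareClass K) : ℤˣ :=
  Quotient.liftOn₂' a b hilbertSymbol (by
    intro a₁ b₁ a₂ b₂ ha hb
    rw [QuotientGroup.leftRel_apply] at ha hb
    obtain ⟨s, hs⟩ := Subgroup.mem_square.mp ha
    obtain ⟨t, ht⟩ := Subgroup.mem_square.mp hb
    rw [inv_mul_eq_iff_eq_mul] at hs ht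
    rw [hs, ht, hilbertSymbol_mul_sq])

/-- The squareclass of `-1`. -/
def negOne : SquareClass K := sqClass (-1)

/-- The Hasse invariant `∏_{i < j} (a_i, a_j)` of the diagonal form `a_1 x_1² + ⋯ + a_n x_n²`. -/
def hasse {n : ℕ} (a : Fin n → Kˣ) : ℤˣ :=
  ∏ i, ∏ j ∈ Finset.Ioi i, hilbertSymbol (a i) (a j)

/-- The diagonal form `a_1 x_1² + ⋯ + a_n x_n²`. -/
def diag {n : ℕ} (a : Fin n → Kˣ) : QuadraticForm K (Fin n → K) :=
  QuadraticMap.weightedSumSquares K fun i => (a i : K)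

/-- The hyperbolic plane: the quadratic form `x y` on `K²`. -/
def hyperbolicPlane (K : Type*) [Field K] : QuadraticForm K (K × K) :=
  QuadraticMap.linMulLin (LinearMap.fst K K K) (LinearMap.snd K K K)

/-- `ℍ^r`, the orthogonal sum of `r` hyperbolic planes. -/
def hyperbolic (K : Type*) [Field K] (r : ℕ) : QuadraticForm K (Fin r → K × K) :=
  QuadraticMap.pi fun _ => hyperbolicPlane K

/-- The norm form `x² - a y² - b z² + a b t²` of the quaternion algebra `(a, b)`; this algebra is
a division algebra exactly when the form is anisotropic. -/
def quaternionNorm (a b : Kˣ) : QuadraticForm K (Fin 4 → K) := diag ![1, -a, -b, a * b]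

end Hilbert

section Invariants

variable {K : Type*} [Field K] {V : Type*} [AddCommGroup V] [Module K V]

/-- `Q` has standard invariants `(n, d, c)`: `n` is the dimension and, in the coordinates of
some orthogonal basis, `Q = a_1 x_1² + ⋯ + a_n x_n²` with `d` the squareclass of `∏ a_i` and
`c = ∏_{i < j} (a_i, a_j)`. -/
def HasStd (Q : QuadraticForm K V) (s : ℕ × SquareClass K × ℤˣ) : Prop :=
  Module.finrank K V = s.1 ∧
    ∃ a : Fin s.1 → Kˣ, Q.Equivalent (diag a) ∧ s.2.1 = sqClass (∏ i, a i) ∧ s.2.2 = hasse a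

/-- `Q` has local invariants `(n, δ, w)` in the sense of Gan, Hanke and Yu, read off from
the normal form of the space. -/
inductive HasGHY (Q : QuadraticForm K V) : ℕ × SquareClass K × ℤˣ → Prop
  /-- `ℍ^r` -/
  | split_even (r : ℕ) (h : Q.Equivalent (hyperbolic K r)) :
      HasGHY Q (2 * r, 1, 1)
  /-- `ℍ^(r-2) ⊕ D`, with `D` the norm form of a quaternion division algebra -/
  | quaternion (r : ℕ) (hr : 2 ≤ r) (a b : Kˣ) (hD : (quaternionNorm a b).Anisotropic)
      (h : Q.Equivalent ((hyperbolic K (r - 2)).prod (quaternionNorm a b))) :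
      HasGHY Q (2 * r, 1, -1)
  /-- `ℍ^(r-1) ⊕ α (x² - δ y²)`, `δ` not a square; `w` is the Hasse invariant of the
  anisotropic part -/
  | binary (r : ℕ) (hr : 1 ≤ r) (α δ : Kˣ) (hδ : ¬ IsSquare δ)
      (h : Q.Equivalent ((hyperbolic K (r - 1)).prod (diag ![α, -(α * δ)]))) :
      HasGHY Q (2 * r, sqClass δ, hasse ![α, -(α * δ)])
  /-- `ℍ^r ⊕ δ x²` -/
  | split_odd (r : ℕ) (δ : Kˣ) (h : Q.Equivalent ((hyperbolic K r).prod (diag ![δ]))) :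
      HasGHY Q (2 * r + 1, sqClass δ, 1)
  /-- `ℍ^(r-1) ⊕ -δ (a x² + b y² + a b z²)`, the ternary form being anisotropic -/
  | ternary (r : ℕ) (hr : 1 ≤ r) (a b δ : Kˣ)
      (hT : (diag ![-δ * a, -δ * b, -δ * (a * b)]).Anisotropic)
      (h : Q.Equivalent ((hyperbolic K (r - 1)).prod (diag ![-δ * a, -δ * b, -δ * (a * b)]))) :
      HasGHY Q (2 * r + 1, sqClass δ, -1)

/-- `Q` has anisotropic dimension `m`: it is the orthogonal sum of hyperbolic planes and
an anisotropic form of dimension `m`. -/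
def HasAnisoDim (Q : QuadraticForm K V) (m : ℕ) : Prop :=
  ∃ (k : ℕ) (A : QuadraticForm K (Fin m → K)),
    A.Anisotropic ∧ Q.Equivalent ((hyperbolic K k).prod A)

end Invariants

section Tables

variable (K : Type*) [Field K]

/-- The triples `(n, d, c)` of standard invariants of the nondegenerate quadratic spaces. -/
def stdTriples : Set (ℕ × SquareClass K × ℤˣ) :=
  {s | ∃ (V : Type u) (_ : AddCommGroup V) (_ : Module K V) (Q : QuadraticForm K V),
    FiniteDimensional K V ∧ Q.Nondegenerate ∧ HasStd Q s}

/-- The triples `(n, δ, w)` of Gan-Hanke-Yu invariants of the nondegenerate quadratic spaces. -/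
def ghyTriples : Set (ℕ × SquareClass K × ℤˣ) :=
  {g | ∃ (V : Type u) (_ : AddCommGroup V) (_ : Module K V) (Q : QuadraticForm K V),
    FiniteDimensional K V ∧ Q.Nondegenerate ∧ HasGHY Q g}

variable {K}

open Classical in
/-- The column "aniso. dim." of the table, as a function of `(n, δ, w)`. -/
def tableAnisoDim : ℕ × SquareClass K × ℤˣ → ℕ := fun (n, δ, w) =>
  if Even n then
    if δ = 1 then
      if w = 1 then 0 else 4
    else 2
  else
    if w = 1 then 1 else 3

open Classical in
/-- The column `c` of the table, as a function of `(n, δ, w)`, where `n = 2 r` or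
`n = 2 r + 1`. -/
def tableHasse : ℕ × SquareClass K × ℤˣ → ℤˣ := fun (n, δ, w) =>
  let r := n / 2
  let ε : ℤˣ := hilbertClass (negOne : SquareClass K) negOne
  if Even n then
    if δ = 1 then
      if w = 1 then ε ^ (r / 2) else -ε ^ (r / 2)
    else ε ^ ((r - 1) / 2) * w * hilbertClass (negOne ^ (r - 1)) (negOne * δ)
  else
    if w = 1 then ε ^ (r / 2) * hilbertClass (negOne ^ r) δ
    else -ε ^ ((r - 1) / 2) * hilbertClass (negOne ^ (r - 1)) (negOne * δ) *
      hilbertClass negOne δ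

/-- The table as a map `(n, δ, w) ↦ (n, d, c)`; in all its rows `d = (-1)^r δ`. -/
def ghyToStd (g : ℕ × SquareClass K × ℤˣ) : ℕ × SquareClass K × ℤˣ :=
  (g.1, negOne ^ (g.1 / 2) * g.2.1, tableHasse g)

end Tables

end LocalQuadratic

end

/-! Everything except the last parts holds over any field with 2 ≠ 0 satisfying `IsHilbertField`.
Index two of the norm groups makes the Hilbert symbol bilinear (`IsHilbertField.mul_right`), and a
nonsquare pairs nontrivially with some element. Two facts follow.

Determinant and Hasse invariant do not depend on the diagonalization
(`invariants_eq_of_equivalent`): one coefficient is made common by exchanging binary forms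
(`exists_cons`), then removed by Witt cancellation. Anisotropic forms have dimension at most 4
(`IsHilbertField.le_four_of_anisotropic`), and in dimension 4 they are quaternion norm forms
(`exists_quaternionNorm_equivalent`).

Splitting off hyperbolic planes therefore brings every space to one of the five shapes. Adding r
planes changes (d, c) by an explicit factor (`exists_diag_hyperbolic_prod`), which produces the
table (`HasGHY.hasStd_ghyToStd`).

Uniqueness of (n, δ, w) needs no cancellation of planes: d determines δ, and c changes sign with w
unless n = 1, where only w = 1 occurs. So the table is injective on the triples that occur, and
uniqueness of (n, d, c) pulls back. The dimension m follows, since any decomposition yields a triple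
with table entry m.

For ℚ_p with p odd the hypotheses reduce to squares mod p; for p = 2 the square classes are
generated by -1, 5, 2, and each nontrivial class is treated by hand. -/

namespace LocalQuadratic

open scoped BigOperators

noncomputable section

/-! ### Square classes, and the Hilbert symbol as a norm condition. -/

section Symbol

variable {K : Type*} [Field K]

lemma sqClass_mul (a b : Kˣ) : sqClass (a * b) = sqClass a * sqClass b := rfl

lemma sqClass_eq_iff {a b : Kˣ} : sqClass a = sqClass b ↔ ∃ s : Kˣ, b = a * (s * s) := by
  unfold sqClass
  rw [QuotientGroup.eq, Subgroup.mem_square]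
  constructor
  · rintro ⟨s, hs⟩
    exact ⟨s, by rw [← hs]; simp⟩
  · rintro ⟨s, rfl⟩
    exact ⟨s, by simp⟩

lemma sqClass_eq_one_iff {a : Kˣ} : sqClass a = 1 ↔ IsSquare a := by
  change sqClass a = sqClass 1 ↔ _
  rw [eq_comm, sqClass_eq_iff]
  simp [IsSquare]

lemma sqClass_mul_self (a : Kˣ) : sqClass a * sqClass a = 1 := by
  rw [← sqClass_mul, sqClass_eq_one_iff]
  exact ⟨a, rfl⟩

lemma sqClass_surjective (c : SquareClass K) : ∃ a : Kˣ, sqClass a = c :=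
  QuotientGroup.mk_surjective c

lemma negOne_pow (r : ℕ) : (negOne : SquareClass K) ^ r = sqClass ((-1) ^ r) := rfl

lemma hilbertClass_sqClass (a b : Kˣ) :
    hilbertClass (sqClass a) (sqClass b) = hilbertSymbol a b := rfl

lemma HilbertSolvable.comm {a b : Kˣ} (h : HilbertSolvable a b) : HilbertSolvable b a := by
  obtain ⟨x, y, z, hne, h⟩ := h
  exact ⟨y, x, z, by tauto, by linear_combination h⟩

lemma hilbertSymbol_comm (a b : Kˣ) : hilbertSymbol a b = hilbertSymbol b a := by
  unfold hilbertSymbol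
  congr 1
  exact propext ⟨HilbertSolvable.comm, HilbertSolvable.comm⟩

lemma hilbertSymbol_eq_one_iff {a b : Kˣ} : hilbertSymbol a b = 1 ↔ HilbertSolvable a b := by
  unfold hilbertSymbol
  split_ifs with h <;> simp [h]

lemma hilbertSymbol_congr {a a' b b' : Kˣ} (ha : sqClass a = sqClass a')
    (hb : sqClass b = sqClass b') : hilbertSymbol a b = hilbertSymbol a' b' := by
  rw [← hilbertClass_sqClass, ha, hb, hilbertClass_sqClass]

lemma HilbertSolvable.congr {a a' b b' : Kˣ} (ha : sqClass a = sqClass a')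
    (hb : sqClass b = sqClass b') (h : HilbertSolvable a b) : HilbertSolvable a' b' := by
  rw [← hilbertSymbol_eq_one_iff] at *
  rwa [← hilbertSymbol_congr ha hb]

lemma hilbertSolvable_of_eq {a b : Kˣ} (x y : K) (h : (b : K) = x ^ 2 - a * y ^ 2) :
    HilbertSolvable a b :=
  ⟨y, 1, x, by simp, by rw [h]; ring⟩

lemma hilbertSolvable_iff [NeZero (2 : K)] {a b : Kˣ} :
    HilbertSolvable a b ↔ ∃ x y : K, (b : K) = x ^ 2 - a * y ^ 2 := by
  refine ⟨?_, fun ⟨x, y, h⟩ => hilbertSolvable_of_eq x y h⟩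
  rintro ⟨x, y, z, hne, h⟩
  have h2 : (2 : K) ≠ 0 := NeZero.ne _
  by_cases hy : y = 0
  · subst hy
    have hx : x ≠ 0 := by
      rintro rfl
      simp_all
    have hz : z ≠ 0 := by
      rintro rfl
      simp_all
    -- Here a is the square of z / x, so x² - a y² is hyperbolic and represents b as ((b+1)/2)² -
    -- ((b-1)/2)².
    refine ⟨(b + 1) / 2, (b - 1) / 2 * (x / z), ?_⟩
    have hz2 : z ^ 2 = a * x ^ 2 := by linear_combination -h
    rw [mul_pow, div_pow x, hz2]
    field_simp
    ring
  · refine ⟨z / y, x / y, ?_⟩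
    field_simp
    linear_combination h

/-- Multiplicativity of the norm from K(√a). -/
lemma HilbertSolvable.mul [NeZero (2 : K)] {a b c : Kˣ} (hb : HilbertSolvable a b)
    (hc : HilbertSolvable a c) : HilbertSolvable a (b * c) := by
  obtain ⟨x, y, hb⟩ := hilbertSolvable_iff.mp hb
  obtain ⟨u, v, hc⟩ := hilbertSolvable_iff.mp hc
  refine hilbertSolvable_of_eq (x * u + a * y * v) (x * v + y * u) ?_
  rw [Units.val_mul, hb, hc]
  ring

lemma hilbertSolvable_neg_self (a : Kˣ) : HilbertSolvable a (-a) :=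
  hilbertSolvable_of_eq 0 1 (by simp)

lemma hilbertSolvable_mul_self (a b : Kˣ) : HilbertSolvable a (b * b) :=
  hilbertSolvable_of_eq b 0 (by simp [sq])

lemma HilbertSolvable.of_isSquare {a b : Kˣ} (hb : IsSquare b) : HilbertSolvable a b := by
  obtain ⟨s, rfl⟩ := hb
  exact hilbertSolvable_mul_self a s

lemma HilbertSolvable.of_mul_left [NeZero (2 : K)] {a b c : Kˣ} (hb : HilbertSolvable a b)
    (h : HilbertSolvable a (b * c)) : HilbertSolvable a c := by
  refine (hb.mul h).congr rfl ?_
  rw [← mul_assoc, sqClass_mul, sqClass_mul, sqClass_mul_self, one_mul]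

lemma hilbertSymbol_mul_self_right (a b : Kˣ) : hilbertSymbol a (b * b) = 1 :=
  hilbertSymbol_eq_one_iff.mpr (hilbertSolvable_mul_self a b)

lemma hilbertSymbol_neg_self (a : Kˣ) : hilbertSymbol a (-a) = 1 :=
  hilbertSymbol_eq_one_iff.mpr (hilbertSolvable_neg_self a)

@[simp] lemma hilbertSymbol_one_right (a : Kˣ) : hilbertSymbol a 1 = 1 := by
  simpa using hilbertSymbol_mul_self_right a 1

@[simp] lemma hilbertSymbol_one_left (a : Kˣ) : hilbertSymbol 1 a = 1 := by
  rw [hilbertSymbol_comm, hilbertSymbol_one_right]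

end Symbol

/-- The properties of the Hilbert symbol of a nonarchimedean local field on which the
classification of quadratic forms rests: for every nonsquare `a` the norms from `K(√a)` form a
subgroup of index two, and some sum of two squares is not a square. -/
structure IsHilbertField (K : Type*) [Field K] : Prop where
  mul_of_not : ∀ a b c : Kˣ, ¬ HilbertSolvable a b → ¬ HilbertSolvable a c →
    HilbertSolvable a (b * c)
  exists_not : ∀ a : Kˣ, ¬ IsSquare a → ∃ b, ¬ HilbertSolvable a b
  exists_sum_two_squares : ∃ c : Kˣ, HilbertSolvable (-1) c ∧ ¬ IsSquare c

/-! ### Bilinearity of the symbol and the bound on anisotropic dimensions. -/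

section Bilinear

variable {K : Type*} [Field K] [NeZero (2 : K)]

namespace IsHilbertField

variable (hK : IsHilbertField K)
include hK

lemma mul_right (a b c : Kˣ) :
    hilbertSymbol a (b * c) = hilbertSymbol a b * hilbertSymbol a c := by
  by_cases hb : HilbertSolvable a b <;> by_cases hc : HilbertSolvable a c
  · simp [hilbertSymbol, hb, hc, hb.mul hc]
  · have : ¬ HilbertSolvable a (b * c) := fun h => hc (hb.of_mul_left h)
    simp [hilbertSymbol, hb, hc, this]
  · have : ¬ HilbertSolvable a (b * c) := fun h => hb (hc.of_mul_left (by rwa [mul_comm]))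
    simp [hilbertSymbol, hb, hc, this]
  · simp [hilbertSymbol, hb, hc, hK.mul_of_not a b c hb hc]

lemma mul_left (a b c : Kˣ) :
    hilbertSymbol (a * b) c = hilbertSymbol a c * hilbertSymbol b c := by
  rw [hilbertSymbol_comm, hK.mul_right, hilbertSymbol_comm c a, hilbertSymbol_comm c b]

lemma self_eq (a : Kˣ) : hilbertSymbol a a = hilbertSymbol (-1) a := by
  have h := hilbertSymbol_neg_self a
  rw [← neg_one_mul, hK.mul_right, hilbertSymbol_comm a (-1)] at h
  rw [eq_comm, ← Int.units_inv_eq_self (hilbertSymbol a a)]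
  exact eq_inv_of_mul_eq_one_left h

lemma prod_right {ι : Type*} (s : Finset ι) (a : Kˣ) (b : ι → Kˣ) :
    hilbertSymbol a (∏ i ∈ s, b i) = ∏ i ∈ s, hilbertSymbol a (b i) := by
  classical
  induction s using Finset.induction_on with
  | empty => simp
  | insert i s hi ih => rw [Finset.prod_insert hi, Finset.prod_insert hi, hK.mul_right, ih]

/-- The characters (a, ·), (b, ·) and their product are all nontrivial, so the joint image in {±1}²
lies in no subgroup of order two and is everything. Products of at most two of the three witnesses
r, s, t suffice. -/
lemma exists_hilbertSymbol_eq {a b : Kˣ} (ha : ¬ IsSquare a) (hb : ¬ IsSquare b)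
    (hab : ¬ IsSquare (a * b)) (e f : ℤˣ) :
    ∃ t : Kˣ, hilbertSymbol a t = e ∧ hilbertSymbol b t = f := by
  have key : ∀ c : Kˣ, ¬ IsSquare c → ∃ t, hilbertSymbol c t = -1 := fun c hc => by
    obtain ⟨t, ht⟩ := hK.exists_not c hc
    exact ⟨t, by simp [hilbertSymbol, ht]⟩
  obtain ⟨r, hr⟩ := key a ha
  obtain ⟨s, hs⟩ := key b hb
  obtain ⟨t, ht⟩ := key _ hab
  rw [hK.mul_left] at ht
  have h1 : hilbertSymbol a 1 = 1 := hilbertSymbol_one_right a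
  have h2 : hilbertSymbol b 1 = 1 := hilbertSymbol_one_right b
  have m1 := hK.mul_right a
  have m2 := hK.mul_right b
  rcases Int.units_eq_one_or e with rfl | rfl <;> rcases Int.units_eq_one_or f with rfl | rfl <;>
  rcases Int.units_eq_one_or (hilbertSymbol b r) with hr' | hr' <;>
  rcases Int.units_eq_one_or (hilbertSymbol a s) with hs' | hs' <;>
  rcases Int.units_eq_one_or (hilbertSymbol a t) with ht' | ht' <;>
  rcases Int.units_eq_one_or (hilbertSymbol b t) with ht'' | ht'' <;>
  first
  | exact absurd ht (by rw [ht', ht'']; decide)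
  | exact ⟨1, h1, h2⟩
  | exact ⟨r, hr, hr'⟩
  | exact ⟨s, hs', hs⟩
  | exact ⟨t, ht', ht''⟩
  | exact ⟨r * s, by rw [m1, hr, hs']; decide, by rw [m2, hr', hs]; decide⟩
  | exact ⟨r * t, by rw [m1, hr, ht']; decide, by rw [m2, hr', ht'']; decide⟩

/-- A binary form of nonsquare discriminant represents every `t` in one class modulo norms. -/
lemma exists_binary_eq {a b t : Kˣ}
    (h : hilbertSymbol (-(a * b)) t = hilbertSymbol (-(a * b)) a) :
    ∃ x y : K, a * x ^ 2 + b * y ^ 2 = t := by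
  have : HilbertSolvable (-(a * b)) (a * t) := by
    rw [← hilbertSymbol_eq_one_iff, hK.mul_right, h, Int.units_mul_self]
  obtain ⟨x, y, hxy⟩ := hilbertSolvable_iff.mp this
  refine ⟨x / a, y, ?_⟩
  push_cast at hxy
  have ha : (a : K) ≠ 0 := a.ne_zero
  field_simp
  linear_combination -hxy

/-- If abcd is not a square, the conditions for ⟨a, b⟩ to represent t and for ⟨c, d⟩ to represent -t
involve independent characters, so some t meets both, and the form is isotropic. -/
lemma isSquare_of_quaternary_anisotropic {a b c d : Kˣ}
    (h : ∀ x y z w : K, a * x ^ 2 + b * y ^ 2 + c * z ^ 2 + d * w ^ 2 = 0 →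
      x = 0 ∧ y = 0 ∧ z = 0 ∧ w = 0) : IsSquare (a * b * (c * d)) := by
  have key : ∀ a b : Kˣ, IsSquare (-(a * b)) → ∃ x : K, a * x ^ 2 + b = 0 := by
    rintro a b ⟨s, hs⟩
    have hs' := congrArg (fun u : Kˣ => (u : K)) hs
    push_cast at hs'
    refine ⟨s / a, ?_⟩
    have ha : (a : K) ≠ 0 := a.ne_zero
    field_simp
    linear_combination -hs'
  by_contra hsq
  have hab : ¬ IsSquare (-(a * b)) := fun hs => by
    obtain ⟨x, hx⟩ := key a b hs
    simpa using (h x 1 0 0 (by linear_combination hx)).2.1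
  have hcd : ¬ IsSquare (-(c * d)) := fun hs => by
    obtain ⟨x, hx⟩ := key c d hs
    simpa using (h 0 0 x 1 (by linear_combination hx)).2.2.2
  obtain ⟨t, h1, h2⟩ := hK.exists_hilbertSymbol_eq hab hcd (by rwa [neg_mul_neg])
    (hilbertSymbol (-(a * b)) a) (hilbertSymbol (-(c * d)) (-1) * hilbertSymbol (-(c * d)) c)
  obtain ⟨x, y, hxy⟩ := hK.exists_binary_eq h1
  obtain ⟨z, w, hzw⟩ := hK.exists_binary_eq (a := c) (b := d) (t := -1 * t) (by
    rw [hK.mul_right, h2, ← mul_assoc, Int.units_mul_self, one_mul])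
  push_cast at hzw
  obtain ⟨rfl, rfl, -, -⟩ := h x y z w (by linear_combination hxy + hzw)
  exact t.ne_zero (by rw [← hxy]; ring)

/-- Any four of the five coefficients have square product, so all lie in one class and the form is a
multiple of a sum of five squares. For a nonsquare k that is a sum of two squares, ⟨k, 1, 1, 1⟩ is
then an anisotropic form of nonsquare determinant. -/
lemma not_quinary_anisotropic (a b c d e : Kˣ)
    (h : ∀ x y z w v : K, a * x ^ 2 + b * y ^ 2 + c * z ^ 2 + d * w ^ 2 + e * v ^ 2 = 0 →
      x = 0 ∧ y = 0 ∧ z = 0 ∧ w = 0 ∧ v = 0) : False := by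
  have he := hK.isSquare_of_quaternary_anisotropic (a := a) (b := b) (c := c) (d := d)
    fun x y z w h0 => by have := h x y z w 0 (by linear_combination h0); tauto
  have hd := hK.isSquare_of_quaternary_anisotropic (a := a) (b := b) (c := c) (d := e)
    fun x y z v h0 => by have := h x y z 0 v (by linear_combination h0); tauto
  have hc := hK.isSquare_of_quaternary_anisotropic (a := a) (b := b) (c := d) (d := e)
    fun x y w v h0 => by have := h x y 0 w v (by linear_combination h0); tauto
  have hb := hK.isSquare_of_quaternary_anisotropic (a := a) (b := c) (c := d) (d := e)
    fun x z w v h0 => by have := h x 0 z w v (by linear_combination h0); tauto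
  have ha := hK.isSquare_of_quaternary_anisotropic (a := b) (b := c) (c := d) (d := e)
    fun y z w v h0 => by have := h 0 y z w v (by linear_combination h0); tauto
  have key : ∀ f : Kˣ, sqClass e = sqClass f → ∃ s : Kˣ, (f : K) * (s * s) = e := fun f hf => by
    obtain ⟨s, hs⟩ := sqClass_eq_iff.mp hf.symm
    exact ⟨s, by rw [hs]; push_cast; ring⟩
  simp only [← sqClass_eq_one_iff, sqClass_mul] at he hd hc hb ha
  have cancel : ∀ m u v : SquareClass K, m * u = 1 → m * v = 1 → u = v := fun m u v hu hv =>
    mul_left_cancel (hu.trans hv.symm)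
  obtain ⟨s, hs⟩ := key a (cancel (sqClass b * sqClass c * sqClass d) _ _
    (by rw [← ha]; simp only [mul_assoc]) (by rw [← he]; ac_rfl))
  obtain ⟨t, ht⟩ := key b (cancel (sqClass a * sqClass c * sqClass d) _ _
    (by rw [← hb]; simp only [mul_assoc]) (by rw [← he]; ac_rfl))
  obtain ⟨u, hu⟩ := key c (cancel (sqClass a * sqClass b * sqClass d) _ _
    (by rw [← hc]; simp only [mul_assoc]) (by rw [← he]; ac_rfl))
  obtain ⟨v, hv⟩ := key d (cancel (sqClass a * sqClass b * sqClass c) _ _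
    (by rw [← hd]; simp only [mul_assoc]) (by rw [← he]; ac_rfl))
  obtain ⟨k, hk, hk'⟩ := hK.exists_sum_two_squares
  obtain ⟨x, y, hxy⟩ := hilbertSolvable_iff.mp hk
  push_cast at hxy
  refine hk' ?_
  have := hK.isSquare_of_quaternary_anisotropic (a := k) (b := 1) (c := 1) (d := 1)
    fun X Y Z W h0 => by
      have := h (s * (x * X)) (t * (y * X)) (u * Y) (v * Z) W (by
        push_cast at h0
        linear_combination (e : K) * h0 + (x * X) ^ 2 * hs + (y * X) ^ 2 * ht + Y ^ 2 * hu
          + Z ^ 2 * hv - e * X ^ 2 * hxy)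
      simp only [mul_eq_zero, Units.ne_zero, false_or] at this
      refine ⟨?_, this.2.2⟩
      by_contra hX
      apply k.ne_zero
      rw [hxy]
      simp [this.1.resolve_right hX, this.2.1.resolve_right hX]
  simpa using this

end IsHilbertField

end Bilinear

/-! ### Reflections and Witt cancellation of a line. -/

section Witt

variable {K : Type*} [Field K] {V : Type*} [AddCommGroup V] [Module K V]

lemma equivalent_of_linearEquiv {V₁ V₂ : Type*} [AddCommGroup V₁] [Module K V₁] [AddCommGroup V₂]
    [Module K V₂] {Q₁ : QuadraticForm K V₁} {Q₂ : QuadraticForm K V₂} (e : V₁ ≃ₗ[K] V₂)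
    (h : ∀ x, Q₂ (e x) = Q₁ x) : Q₁.Equivalent Q₂ :=
  ⟨⟨e, h⟩⟩

lemma Anisotropic.of_equivalent {V₁ V₂ : Type*} [AddCommGroup V₁] [Module K V₁]
    [AddCommGroup V₂] [Module K V₂] {Q₁ : QuadraticForm K V₁} {Q₂ : QuadraticForm K V₂}
    (h : Q₁.Equivalent Q₂) (h₁ : Q₁.Anisotropic) : Q₂.Anisotropic := by
  obtain ⟨e⟩ := h.symm
  intro x hx
  have := h₁ (e x) (by rw [e.map_app, hx])
  exact e.toLinearEquiv.map_eq_zero_iff.mp this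

/-- The reflection in a vector `u` with `Q u ≠ 0`. -/
def reflection (Q : QuadraticForm K V) (u : V) (hu : Q u ≠ 0) : Q.IsometryEquiv Q where
  toLinearEquiv := LinearEquiv.ofInvolutive
    (LinearMap.id - ((Q u)⁻¹ • (Q.polarBilin u)).smulRight u) (fun x => by
      have h : QuadraticMap.polar Q u u = 2 * Q u := by
        rw [QuadraticMap.polar_self, nsmul_eq_mul, Nat.cast_ofNat]
      simp only [LinearMap.sub_apply, LinearMap.id_apply, LinearMap.smulRight_apply,
        LinearMap.smul_apply, QuadraticMap.polarBilin_apply_apply, QuadraticMap.polar_sub_right,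
        QuadraticMap.polar_smul_right, h, smul_eq_mul]
      rw [sub_sub, ← add_smul, sub_eq_self, smul_eq_zero]
      left
      field_simp
      ring)
  map_app' x := by
    change Q (x - ((Q u)⁻¹ * QuadraticMap.polar Q u x) • u) = Q x
    rw [sub_eq_add_neg, ← neg_smul, QuadraticMap.map_add Q, QuadraticMap.map_smul,
      QuadraticMap.polar_smul_right, QuadraticMap.polar_comm Q x u, smul_eq_mul, smul_eq_mul]
    field_simp
    ring

lemma reflection_apply (Q : QuadraticForm K V) (u : V) (hu : Q u ≠ 0) (x : V) :
    reflection Q u hu x = x - ((Q u)⁻¹ * QuadraticMap.polar Q u x) • u := rfl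

/-- Since Q(v + w) + Q(v - w) = 4 Q(v) ≠ 0, one of v ± w is anisotropic. Reflection in v - w sends v
to w; reflection in v + w sends v to -w. -/
lemma exists_isometryEquiv_apply_eq [NeZero (2 : K)] (Q : QuadraticForm K V) {v w : V}
    (h : Q v = Q w) (hv : Q v ≠ 0) : ∃ σ : Q.IsometryEquiv Q, σ v = w := by
  have hself : QuadraticMap.polar Q v v = 2 * Q v := by
    rw [QuadraticMap.polar_self, nsmul_eq_mul, Nat.cast_ofNat]
  have hadd := QuadraticMap.map_add Q v w
  have hsub := QuadraticMap.map_add Q v (-w)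
  rw [← sub_eq_add_neg, QuadraticMap.map_neg, QuadraticMap.polar_neg_right] at hsub
  by_cases hd : Q (v - w) = 0
  · have hs : Q (v + w) ≠ 0 := by
      have : Q (v + w) = 2 * (2 * Q v) := by linear_combination hadd + hsub - hd - 2 * h
      rw [this]
      exact mul_ne_zero (NeZero.ne _) (mul_ne_zero (NeZero.ne _) hv)
    refine ⟨(reflection Q (v + w) hs).trans ⟨LinearEquiv.neg K, fun x => Q.map_neg x⟩, ?_⟩
    change -(reflection Q (v + w) hs v) = w
    have : (Q (v + w))⁻¹ * QuadraticMap.polar Q (v + w) v = 1 := by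
      rw [inv_mul_eq_one₀ hs, QuadraticMap.polar_add_left, QuadraticMap.polar_comm Q w v]
      linear_combination hadd - hself - h
    rw [reflection_apply, this, one_smul]
    abel
  · refine ⟨reflection Q (v - w) hd, ?_⟩
    have : (Q (v - w))⁻¹ * QuadraticMap.polar Q (v - w) v = 1 := by
      rw [inv_mul_eq_one₀ hd, QuadraticMap.polar_sub_left, QuadraticMap.polar_comm Q w v]
      linear_combination hsub - hself - h
    rw [reflection_apply, this, one_smul]
    abel

/-- The unary form `a x²`. -/
def unary (a : Kˣ) : QuadraticForm K K := (a : K) • QuadraticMap.sq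

@[simp] lemma unary_apply (a : Kˣ) (x : K) : unary a x = a * (x * x) := by
  simp [unary]

/-- An isometry fixing (1, 0) preserves its orthogonal complement; this is read off by comparing
values at (0, y) and (1, y). -/
lemma fst_eq_zero_of_fixes [NeZero (2 : K)] {U W : Type*} [AddCommGroup U] [Module K U]
    [AddCommGroup W] [Module K W] {A : QuadraticForm K U} {B : QuadraticForm K W} {t : Kˣ}
    (f : ((unary t).prod A).IsometryEquiv ((unary t).prod B)) (hf : f (1, 0) = (1, 0)) (y : U) :
    (f (0, y)).1 = 0 := by
  have h := f.map_app ((1, 0) + (0, y))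
  have h' := f.map_app (0, y)
  have hadd : f ((1, 0) + (0, y)) = f (1, 0) + f (0, y) := map_add f.toLinearEquiv _ _
  rw [hadd, hf] at h
  simp only [QuadraticMap.prod_apply, unary_apply, Prod.fst_add, Prod.snd_add, add_zero,
    zero_add] at h h'
  have : (t : K) * (2 * (f (0, y)).1) = 0 := by linear_combination h - h'
  simpa [NeZero.ne] using this

lemma unary_cancel [NeZero (2 : K)] {U W : Type*} [AddCommGroup U] [Module K U]
    [AddCommGroup W] [Module K W] {A : QuadraticForm K U} {B : QuadraticForm K W} {t : Kˣ}
    (h : ((unary t).prod A).Equivalent ((unary t).prod B)) : A.Equivalent B := by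
  obtain ⟨f⟩ := h
  obtain ⟨σ, hσ⟩ := exists_isometryEquiv_apply_eq ((unary t).prod B)
    (v := f (1, 0)) (w := (1, 0)) (by rw [f.map_app]; simp) (by rw [f.map_app]; simp)
  set g := f.trans σ with hg
  have hg1 : g (1, 0) = (1, 0) := hσ
  have hg2 : g.symm (1, 0) = (1, 0) := by rw [g.symm_apply_eq, hg1]
  have k1 := fst_eq_zero_of_fixes g hg1
  have k2 := fst_eq_zero_of_fixes g.symm hg2
  have e1 : ∀ y, g (0, y) = (0, (g (0, y)).2) := fun y => Prod.ext (k1 y) rfl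
  have e2 : ∀ y, g.symm (0, y) = (0, (g.symm (0, y)).2) := fun y => Prod.ext (k2 y) rfl
  refine equivalent_of_linearEquiv
    (LinearEquiv.ofLinearMap
      (LinearMap.snd K K W ∘ₗ g.toLinearEquiv.toLinearMap ∘ₗ LinearMap.inr K K U)
      (LinearMap.snd K K U ∘ₗ g.symm.toLinearEquiv.toLinearMap ∘ₗ LinearMap.inr K K W)
      (LinearMap.ext fun y => ?_) (LinearMap.ext fun y => ?_)) fun y => ?_
  · change (g (0, (g.symm (0, y)).2)).2 = y
    rw [← e2, g.apply_symm_apply]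
  · change (g.symm (0, (g (0, y)).2)).2 = y
    rw [← e1, g.symm_apply_apply]
  · change B (g (0, y)).2 = A y
    have := g.map_app (0, y)
    rw [e1] at this
    simpa using this

end Witt

/-! ### Diagonal forms and changes of basis. -/

section Diag

variable {K : Type*} [Field K]

lemma diag_apply {n : ℕ} (a : Fin n → Kˣ) (x : Fin n → K) :
    diag a x = ∑ i, (a i : K) * (x i * x i) := by
  simp [diag, QuadraticMap.weightedSumSquares_apply]

lemma diag_cons {n : ℕ} (t : Kˣ) (a : Fin n → Kˣ) :
    ((unary t).prod (diag a)).Equivalent (diag (Fin.cons t a : Fin (n + 1) → Kˣ)) :=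
  equivalent_of_linearEquiv (Fin.consLinearEquiv K fun _ => K) fun x => by
    simp [diag_apply, Fin.sum_univ_succ]

/-- The isomorphism `K² × Kⁿ ≃ Kⁿ⁺²`. -/
def consConsLinearEquiv (K : Type*) [Field K] (n : ℕ) :
    ((K × K) × (Fin n → K)) ≃ₗ[K] (Fin (n + 2) → K) :=
  (LinearEquiv.prodAssoc K K K (Fin n → K)) ≪≫ₗ
    ((LinearEquiv.refl K K).prodCongr (Fin.consLinearEquiv K fun _ => K)) ≪≫ₗ
      (Fin.consLinearEquiv K fun _ => K)

lemma diag_cons_cons {n : ℕ} (s t : Kˣ) (a : Fin n → Kˣ) :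
    (((unary s).prod (unary t)).prod (diag a)).Equivalent
      (diag (Fin.cons s (Fin.cons t a : Fin (n + 1) → Kˣ) : Fin (n + 2) → Kˣ)) :=
  equivalent_of_linearEquiv (consConsLinearEquiv K n) fun x => by
    simp [consConsLinearEquiv, diag_apply, Fin.sum_univ_succ, add_assoc]

lemma diag_cons_congr {n : ℕ} (t : Kˣ) {a b : Fin n → Kˣ} (h : (diag a).Equivalent (diag b)) :
    (diag (Fin.cons t a : Fin (n + 1) → Kˣ)).Equivalent
      (diag (Fin.cons t b : Fin (n + 1) → Kˣ)) :=
  (diag_cons t a).symm.trans (((QuadraticMap.Equivalent.refl _).prod h).trans (diag_cons t b))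

lemma diag_cons_cancel [NeZero (2 : K)] {n : ℕ} {t : Kˣ} {a b : Fin n → Kˣ}
    (h : (diag (Fin.cons t a : Fin (n + 1) → Kˣ)).Equivalent
      (diag (Fin.cons t b : Fin (n + 1) → Kˣ))) : (diag a).Equivalent (diag b) :=
  unary_cancel ((diag_cons t a).trans (h.trans (diag_cons t b).symm))

/-- The new orthogonal basis is (x, 1), of value t, and (-s, a x), of value a s t. -/
lemma binary_equivalent {a s t : Kˣ} {x : K} (h : (t : K) = a * (x * x) + s) :
    ((unary t).prod (unary (a * s * t))).Equivalent ((unary a).prod (unary s)) := by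
  have ht : (t : K) ≠ 0 := t.ne_zero
  refine equivalent_of_linearEquiv
    (LinearEquiv.ofLinearMap
      ((x • LinearMap.fst K K K - (s : K) • LinearMap.snd K K K).prod
        (LinearMap.fst K K K + (a * x : K) • LinearMap.snd K K K))
      (((a * x / t : K) • LinearMap.fst K K K + (s / t : K) • LinearMap.snd K K K).prod
        ((x / t : K) • LinearMap.snd K K K - (1 / t : K) • LinearMap.fst K K K))
      (LinearMap.ext fun y => Prod.ext ?_ ?_) (LinearMap.ext fun y => Prod.ext ?_ ?_))
    fun y => ?_
  · simp
    field_simp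
    rw [h]; ring
  · simp
    field_simp
    rw [h]; ring
  · simp
    field_simp
    rw [h]; ring
  · simp
    field_simp
    rw [h]; ring
  · simp
    rw [h]; ring

lemma unary_congr {a b : Kˣ} (h : sqClass a = sqClass b) : (unary a).Equivalent (unary b) := by
  obtain ⟨s, rfl⟩ := sqClass_eq_iff.mp h.symm
  exact equivalent_of_linearEquiv (LinearEquiv.smulOfUnit s) fun x => by
    change unary b (s * x) = _
    simp
    ring

lemma diag_congr {n : ℕ} {a b : Fin n → Kˣ} (h : ∀ i, sqClass (a i) = sqClass (b i)) :
    (diag a).Equivalent (diag b) := by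
  choose s hs using fun i => sqClass_eq_iff.mp (h i).symm
  refine equivalent_of_linearEquiv (LinearEquiv.piCongrRight fun i => LinearEquiv.smulOfUnit (s i))
    fun x => ?_
  simp only [diag_apply]
  refine Finset.sum_congr rfl fun i _ => ?_
  change (b i : K) * ((s i * x i) * (s i * x i)) = _
  simp [hs i]
  ring

end Diag

/-! ### Invariance of determinant and Hasse invariant. -/

section Invariance

variable {K : Type*} [Field K]

lemma hasse_cons [NeZero (2 : K)] (hK : IsHilbertField K) {n : ℕ} (t : Kˣ) (a : Fin n → Kˣ) :
    hasse (Fin.cons t a : Fin (n + 1) → Kˣ) = hilbertSymbol t (∏ i, a i) * hasse a := by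
  simp [hasse, Fin.prod_univ_succ, Fin.prod_Ioi_succ, hK.prod_right]

/-- A diagonal form that represents `t` has a diagonalization starting with `t`, with the same
determinant and Hasse invariant. -/
lemma exists_cons [NeZero (2 : K)] (hK : IsHilbertField K) {n : ℕ} (a : Fin (n + 1) → Kˣ) (t : Kˣ)
    (x : Fin (n + 1) → K) (hx : diag a x = t) : ∃ b : Fin n → Kˣ,
      (diag a).Equivalent (diag (Fin.cons t b : Fin (n + 1) → Kˣ)) ∧
      sqClass (∏ i, a i) = sqClass (t * ∏ i, b i) ∧
      hasse a = hilbertSymbol t (∏ i, b i) * hasse b := by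
  induction n generalizing t with
  | zero =>
    refine ⟨Fin.elim0, ?_, ?_, ?_⟩
    all_goals
      have h : sqClass t = sqClass (a 0) := by
        have hx' : (a 0 : K) * (x 0 * x 0) = t := by simpa [diag_apply] using hx
        have h0 : x 0 ≠ 0 := fun h0 => t.ne_zero (by rw [← hx', h0]; simp)
        exact (sqClass_eq_iff.mpr ⟨Units.mk0 _ h0, Units.ext (by simp [← hx'])⟩).symm
    · exact diag_congr fun i => by
        rw [Fin.fin_one_eq_zero i]
        exact h.symm
    · simp [h]
    · simp [hasse]
  | succ n ih =>
    obtain ⟨a₀, a, rfl⟩ : ∃ (a₀ : Kˣ) (a' : Fin (n + 1) → Kˣ), a = Fin.cons a₀ a' :=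
      ⟨a 0, Fin.tail a, (Fin.cons_self_tail a).symm⟩
    obtain ⟨x₀, x, rfl⟩ : ∃ (x₀ : K) (x' : Fin (n + 1) → K), x = Fin.cons x₀ x' :=
      ⟨x 0, Fin.tail x, (Fin.cons_self_tail x).symm⟩
    have hx' : (a₀ : K) * (x₀ * x₀) + diag a x = t := by
      rw [← hx, diag_apply (Fin.cons a₀ a), Fin.sum_univ_succ, diag_apply]
      simp only [Fin.cons_zero, Fin.cons_succ]
    rw [hasse_cons hK, Fin.prod_cons]
    by_cases h0 : diag a x = 0
    · have h : sqClass a₀ = sqClass t := by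
        rw [h0, add_zero] at hx'
        have h0 : x₀ ≠ 0 := fun h0 => t.ne_zero (by rw [← hx', h0]; simp)
        exact sqClass_eq_iff.mpr ⟨Units.mk0 _ h0, Units.ext (by simp [← hx'])⟩
      refine ⟨a, ?_, ?_, ?_⟩
      · exact (diag_cons _ _).symm.trans
          (((unary_congr h).prod (QuadraticMap.Equivalent.refl _)).trans (diag_cons _ _))
      · rw [sqClass_mul, h, sqClass_mul]
      · rw [hilbertSymbol_congr h rfl]
    · obtain ⟨s, hs⟩ : ∃ s : Kˣ, diag a x = s := ⟨Units.mk0 _ h0, rfl⟩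
      obtain ⟨b, hb, hd, hc⟩ := ih a s x hs
      have ht : (t : K) = a₀ * (x₀ * x₀) + s := by rw [← hs, hx']
      -- The tail becomes ⟨s⟩ ⊕ b by induction; then ⟨a₀, s⟩ is exchanged for ⟨t, a₀ s t⟩.
      refine ⟨Fin.cons (a₀ * s * t) b, ?_, ?_, ?_⟩
      · exact (diag_cons_congr a₀ hb).trans ((diag_cons_cons _ _ _).symm.trans
          (((binary_equivalent ht).symm.prod (QuadraticMap.Equivalent.refl _)).trans
            (diag_cons_cons _ _ _)))
      · rw [sqClass_mul, hd, Fin.prod_cons]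
        simp only [sqClass_mul]
        calc _ = sqClass t * sqClass t * (sqClass a₀ * (sqClass s * sqClass (∏ i, b i))) := by
              rw [sqClass_mul_self, one_mul]
          _ = _ := by ac_rfl
      · rw [hasse_cons hK, hc, Fin.prod_cons, hilbertSymbol_congr (rfl : sqClass a₀ = _) hd]
        -- Multiplying t = a₀ x₀² + s by t gives (a₀ t, s t) = 1, which expands to this identity.
        have key : hilbertSymbol (a₀ * s) t = hilbertSymbol a₀ s * hilbertSymbol (-1) t := by
          have : HilbertSolvable (a₀ * t) (s * t) := ⟨x₀, 1, t, by simp, by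
            push_cast; linear_combination (-t : K) * ht⟩
          rw [← hilbertSymbol_eq_one_iff, hK.mul_right, hK.mul_left, hK.mul_left, hK.self_eq,
            hilbertSymbol_comm t s] at this
          rw [hK.mul_left]
          generalize hilbertSymbol a₀ s = p at *
          generalize hilbertSymbol a₀ t = q at *
          generalize hilbertSymbol s t = r at *
          generalize hilbertSymbol (-1) t = u at *
          revert p q r u
          decide
        rw [hK.mul_left (a₀ * s) t, hK.mul_right t, hK.mul_right t, hK.self_eq t,
          hilbertSymbol_comm t (a₀ * s), key, hK.mul_left a₀ s, hK.mul_right a₀ s]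
        generalize hilbertSymbol a₀ s = p
        generalize hilbertSymbol (-1) t = q
        generalize hilbertSymbol t _ = r
        generalize hilbertSymbol a₀ _ = u
        generalize hilbertSymbol s _ = v
        generalize hasse b = w
        revert p q r u v w
        decide

/-- Induction on n: `diag a` represents the first coefficient of b, so it can be rediagonalized to
start with it without changing the invariants; that coefficient is then cancelled. -/
lemma invariants_eq_of_equivalent [NeZero (2 : K)] (hK : IsHilbertField K) {n : ℕ}
    (a b : Fin n → Kˣ) (h : (diag a).Equivalent (diag b)) :
    sqClass (∏ i, a i) = sqClass (∏ i, b i) ∧ hasse a = hasse b := by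
  induction n with
  | zero => rw [Subsingleton.elim a b]; simp
  | succ n ih =>
    obtain ⟨t, b, rfl⟩ : ∃ (b₀ : Kˣ) (b' : Fin n → Kˣ), b = Fin.cons b₀ b' :=
      ⟨b 0, Fin.tail b, (Fin.cons_self_tail b).symm⟩
    obtain ⟨e⟩ := id h.symm
    obtain ⟨a', ha, hd, hc⟩ := exists_cons hK a t (e (Fin.cons 1 0)) (by
      rw [e.map_app, diag_apply, Fin.sum_univ_succ]
      simp)
    obtain ⟨h1, h2⟩ := ih a' b (diag_cons_cancel (ha.symm.trans h))
    rw [hd, hc, hasse_cons hK, hilbertSymbol_congr rfl h1, h2, Fin.prod_univ_succ]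
    simp [sqClass_mul, h1]

lemma HasStd.unique [NeZero (2 : K)] (hK : IsHilbertField K) {V : Type*} [AddCommGroup V]
    [Module K V] {Q : QuadraticForm K V} {s s' : ℕ × SquareClass K × ℤˣ} (h : HasStd Q s)
    (h' : HasStd Q s') : s = s' := by
  obtain ⟨n, d, c⟩ := s
  obtain ⟨n', d', c'⟩ := s'
  obtain ⟨hn, a, ha, hd, hc⟩ := h
  obtain ⟨hn', a', ha', hd', hc'⟩ := h'
  simp only at *
  obtain rfl : n = n' := hn.symm.trans hn'
  obtain ⟨h1, h2⟩ := invariants_eq_of_equivalent hK a a' (ha.symm.trans ha')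
  rw [hd, hd', hc, hc', h1, h2]

end Invariance

/-! ### Invariants of a form with hyperbolic planes added. -/

section Hyperbolic

variable {K : Type*} [Field K]

lemma hyperbolic_apply (r : ℕ) (x : Fin r → K × K) :
    hyperbolic K r x = ∑ i, (x i).1 * (x i).2 := by
  simp [hyperbolic, hyperbolicPlane]

lemma hyperbolic_zero_prod {V : Type*} [AddCommGroup V] [Module K V] (A : QuadraticForm K V) :
    ((hyperbolic K 0).prod A).Equivalent A :=
  equivalent_of_linearEquiv LinearEquiv.uniqueProd fun x => by simp [hyperbolic_apply]

lemma hyperbolic_succ_prod {V : Type*} [AddCommGroup V] [Module K V] (r : ℕ)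
    (A : QuadraticForm K V) :
    ((hyperbolic K (r + 1)).prod A).Equivalent
      ((hyperbolicPlane K).prod ((hyperbolic K r).prod A)) := by
  refine QuadraticMap.Equivalent.symm (equivalent_of_linearEquiv
    ((LinearEquiv.prodAssoc K _ _ _).symm ≪≫ₗ
      (Fin.consLinearEquiv K fun _ => K × K).prodCongr (LinearEquiv.refl K V)) fun x => ?_)
  simp [hyperbolic_apply, hyperbolicPlane, Fin.sum_univ_succ, add_assoc]
  rfl

lemma prod_diag_fin_zero {V : Type*} [AddCommGroup V] [Module K V] (A : QuadraticForm K V)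
    (B : QuadraticForm K (Fin 0 → K)) : (A.prod B).Equivalent A :=
  equivalent_of_linearEquiv LinearEquiv.prodUnique fun x => by
    rw [QuadraticMap.prod_apply, Subsingleton.elim x.2 0, QuadraticMap.map_zero]
    simp

variable [NeZero (2 : K)]

lemma hyperbolicPlane_equivalent :
    ((unary (1 : Kˣ)).prod (unary (-1))).Equivalent (hyperbolicPlane K) := by
  have h2 : (2 : K) ≠ 0 := NeZero.ne _
  refine equivalent_of_linearEquiv (LinearEquiv.ofLinearMap
      ((LinearMap.fst K K K + LinearMap.snd K K K).prod
        (LinearMap.fst K K K - LinearMap.snd K K K))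
      (((1 / 2 : K) • LinearMap.fst K K K + (1 / 2 : K) • LinearMap.snd K K K).prod
        ((1 / 2 : K) • LinearMap.fst K K K - (1 / 2 : K) • LinearMap.snd K K K))
      (LinearMap.ext fun y => Prod.ext ?_ ?_) (LinearMap.ext fun y => Prod.ext ?_ ?_))
    fun y => ?_
  · simp
    field_simp
    ring
  · simp
    field_simp
    ring
  · simp
    field_simp
    ring
  · simp
    field_simp
    ring
  · simp [hyperbolicPlane]
    ring

lemma hyperbolicPlane_prod_diag {n : ℕ} (a : Fin n → Kˣ) :
    ((hyperbolicPlane K).prod (diag a)).Equivalent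
      (diag (Fin.cons 1 (Fin.cons (-1) a : Fin (n + 1) → Kˣ) : Fin (n + 2) → Kˣ)) :=
  (hyperbolicPlane_equivalent.symm.prod (QuadraticMap.Equivalent.refl _)).trans
    (diag_cons_cons _ _ _)

lemma exists_diag_hyperbolic_prod (hK : IsHilbertField K) {m : ℕ} (v : Fin m → Kˣ) (r N : ℕ)
    (hN : N = 2 * r + m) : ∃ a : Fin N → Kˣ,
      ((hyperbolic K r).prod (diag v)).Equivalent (diag a) ∧
      sqClass (∏ i, a i) = sqClass ((-1) ^ r * ∏ i, v i) ∧
      hasse a = hilbertSymbol (-1 : Kˣ) (-1) ^ (r / 2) * hilbertSymbol ((-1) ^ r) (∏ i, v i) *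
        hasse v := by
  induction r generalizing N with
  | zero =>
    obtain rfl : N = m := by omega
    exact ⟨v, hyperbolic_zero_prod _, by simp, by simp⟩
  | succ r ih =>
    obtain rfl : N = 2 * r + m + 2 := by omega
    obtain ⟨a, ha, hd, hc⟩ := ih _ rfl
    refine ⟨Fin.cons 1 (Fin.cons (-1) a : Fin (2 * r + m + 1) → Kˣ), ?_, ?_, ?_⟩
    · exact (hyperbolic_succ_prod r _).trans
        (((QuadraticMap.Equivalent.refl _).prod ha).trans (hyperbolicPlane_prod_diag a))
    · rw [Fin.prod_cons, Fin.prod_cons, one_mul, sqClass_mul, hd, ← sqClass_mul, pow_succ']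
      rw [mul_assoc]
    · rw [hasse_cons hK, hasse_cons hK, hilbertSymbol_one_left, one_mul,
        hilbertSymbol_congr (rfl : sqClass (-1 : Kˣ) = _) hd, hc, hK.mul_right, pow_succ' (-1 : Kˣ),
        hK.mul_left (-1) ((-1) ^ r)]
      have hpow : hilbertSymbol (-1 : Kˣ) ((-1) ^ r) = hilbertSymbol (-1 : Kˣ) (-1) ^ r := by
        simpa using hK.prod_right (Finset.range r) (-1) fun _ => -1
      -- The accumulated exponent of (-1, -1) is 0 + 1 + ⋯ + (r - 1), which has the parity of ⌊r/2⌋.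
      have hparity : hilbertSymbol (-1 : Kˣ) (-1) ^ ((r + 1) / 2) =
          hilbertSymbol (-1 : Kˣ) (-1) ^ r * hilbertSymbol (-1 : Kˣ) (-1) ^ (r / 2) := by
        rw [← pow_add, show r + r / 2 = (r + 1) / 2 + 2 * (r / 2) by omega, pow_add, pow_mul,
          Int.units_sq, one_pow, mul_one]
      rw [hpow, hparity]
      ac_rfl

end Hyperbolic

/-! ### Existence of the standard invariants. -/

section Std

variable {K : Type*} [Field K] {V : Type*} [AddCommGroup V] [Module K V] {Q : QuadraticForm K V}

lemma hasStd_of_equivalent {n : ℕ} {a : Fin n → Kˣ} (h : Q.Equivalent (diag a)) :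
    HasStd Q (n, sqClass (∏ i, a i), hasse a) := by
  refine ⟨?_, a, h, rfl, rfl⟩
  obtain ⟨e⟩ := h
  simpa using e.toLinearEquiv.finrank_eq

lemma hasStd_of_hyperbolic_prod [NeZero (2 : K)] (hK : IsHilbertField K) {m r : ℕ}
    {v : Fin m → Kˣ} (h : Q.Equivalent ((hyperbolic K r).prod (diag v))) :
    HasStd Q (2 * r + m, sqClass ((-1) ^ r * ∏ i, v i),
      hilbertSymbol (-1 : Kˣ) (-1) ^ (r / 2) * hilbertSymbol ((-1) ^ r) (∏ i, v i) *
        hasse v) := by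
  obtain ⟨a, ha, hd, hc⟩ := exists_diag_hyperbolic_prod hK v r _ rfl
  rw [← hd, ← hc]
  exact hasStd_of_equivalent (h.trans ha)

lemma exists_diag_of_separatingLeft [Invertible (2 : K)] [FiniteDimensional K V]
    (h : (QuadraticMap.associated (R := K) Q).SeparatingLeft) :
    ∃ a : Fin (Module.finrank K V) → Kˣ, Q.Equivalent (diag a) := by
  obtain ⟨a, ha⟩ := QuadraticForm.equivalent_weightedSumSquares_units_of_nondegenerate' Q h
  refine ⟨a, ?_⟩
  convert ha using 1
  ext x
  simp [diag_apply, QuadraticMap.weightedSumSquares_apply, Units.smul_def]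

end Std

/-! ### Splitting off hyperbolic planes. -/

section Decomposition

variable {K : Type*} [Field K] [NeZero (2 : K)]

lemma exists_diag_eq_of_isotropic {n : ℕ} {a : Fin n → Kˣ} (h : ¬ (diag a).Anisotropic) (t : K) :
    ∃ x, diag a x = t := by
  obtain ⟨x, hx, hx0⟩ := (QuadraticMap.not_anisotropic_iff_exists _).mp h
  obtain ⟨i, hi⟩ := Function.ne_iff.mp hx
  simp only [Pi.zero_apply] at hi
  have h2 : (2 : K) ≠ 0 := NeZero.ne _
  -- For isotropic x with x i ≠ 0, the value at e_i + c x is a i + 2 c a i x i, linear in c with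
  -- nonzero slope.
  refine ⟨Pi.single i 1 + ((t - a i) / (2 * (a i * x i))) • x, ?_⟩
  have hs : diag a (Pi.single i 1) = a i := by
    simp [diag_apply, Pi.single_apply]
  have hp : QuadraticMap.polar (diag a) (Pi.single i 1) x = 2 * (a i * x i) := by
    have key : diag a (Pi.single i 1 + x) = ∑ j, ((a j : K) * (x j * x j) +
        if j = i then (a j : K) * (1 + 2 * x j) else 0) := by
      rw [diag_apply]
      refine Finset.sum_congr rfl fun j _ => ?_
      by_cases hj : j = i
      · subst hj
        simp
        ring
      · simp [hj]
    rw [QuadraticMap.polar, key, Finset.sum_add_distrib, ← diag_apply, hx0, hs]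
    simp
    ring
  rw [QuadraticMap.map_add (diag a), QuadraticMap.map_smul, hx0, hs, QuadraticMap.polar_smul_right,
    hp]
  have hai : (a i : K) ≠ 0 := (a i).ne_zero
  simp only [smul_eq_mul]
  field_simp
  ring

lemma exists_diag_eq_neg_one_of_isotropic {n : ℕ} {b : Fin n → Kˣ}
    (h : ¬ (diag (Fin.cons 1 b : Fin (n + 1) → Kˣ)).Anisotropic) : ∃ x, diag b x = -1 := by
  by_cases hb : (diag b).Anisotropic
  · obtain ⟨x, hx, hx0⟩ := (QuadraticMap.not_anisotropic_iff_exists _).mp h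
    obtain ⟨x₀, x, rfl⟩ : ∃ (x₀ : K) (x' : Fin n → K), x = Fin.cons x₀ x' :=
      ⟨x 0, Fin.tail x, (Fin.cons_self_tail x).symm⟩
    have hx0' : x₀ * x₀ + diag b x = 0 := by
      rw [← hx0, diag_apply (Fin.cons 1 b), Fin.sum_univ_succ, diag_apply]
      simp
    have h0 : x₀ ≠ 0 := by
      rintro rfl
      refine hx ?_
      rw [hb x (by simpa using hx0')]
      ext i
      refine Fin.cases ?_ (fun j => ?_) i <;> simp
    refine ⟨x₀⁻¹ • x, ?_⟩
    rw [QuadraticMap.map_smul, smul_eq_mul]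
    field_simp
    linear_combination hx0'
  · exact exists_diag_eq_of_isotropic hb _

/-- An isotropic form represents 1, and the complement of such a vector represents -1; together they
span a plane ⟨1, -1⟩, and the dimension drops by two. -/
lemma exists_hyperbolic_decomposition (hK : IsHilbertField K) (n : ℕ) (a : Fin n → Kˣ) :
    ∃ (k m : ℕ) (v : Fin m → Kˣ), (diag v).Anisotropic ∧
      (diag a).Equivalent ((hyperbolic K k).prod (diag v)) := by
  induction n using Nat.strong_induction_on with
  | _ n ih =>
    by_cases ha : (diag a).Anisotropic
    · exact ⟨0, n, a, ha, (hyperbolic_zero_prod _).symm⟩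
    obtain ⟨x, hx⟩ := exists_diag_eq_of_isotropic ha 1
    obtain _ | n := n
    · simp [diag_apply] at hx
    obtain ⟨b, hab, -, -⟩ := exists_cons hK a 1 x (by simpa using hx)
    obtain ⟨y, hy⟩ := exists_diag_eq_neg_one_of_isotropic
      (fun h => ha (Anisotropic.of_equivalent hab.symm h))
    obtain _ | n := n
    · simp [diag_apply] at hy
    obtain ⟨c, hbc, -, -⟩ := exists_cons hK b (-1) y (by simpa using hy)
    obtain ⟨k, m, v, hv, hcv⟩ := ih n (by omega) c
    refine ⟨k + 1, m, v, hv, ?_⟩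
    exact hab.trans ((diag_cons_congr 1 hbc).trans ((hyperbolicPlane_prod_diag c).symm.trans
      (((QuadraticMap.Equivalent.refl _).prod hcv).trans (hyperbolic_succ_prod _ _).symm)))

lemma IsHilbertField.le_four_of_anisotropic (hK : IsHilbertField K) {m : ℕ} {v : Fin m → Kˣ}
    (hv : (diag v).Anisotropic) : m ≤ 4 := by
  by_contra hm
  obtain ⟨n, rfl⟩ : ∃ n, m = n + 5 := ⟨m - 5, by omega⟩
  refine hK.not_quinary_anisotropic (v 0) (v 1) (v 2) (v 3) (v 4) fun x y z w u h => ?_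
  let X : Fin (n + 5) → K :=
    Fin.cons x (Fin.cons y (Fin.cons z (Fin.cons w (Fin.cons u 0 : Fin (n + 1) → K)
      : Fin (n + 2) → K) : Fin (n + 3) → K) : Fin (n + 4) → K)
  have hX : X = 0 := hv _ (by
    rw [diag_apply]
    simp only [Fin.sum_univ_succ, X, Fin.cons_zero, Fin.cons_succ, Pi.zero_apply, mul_zero,
      Finset.sum_const_zero, add_zero]
    rw [← h]
    simp only [sq, ← add_assoc]
    rfl)
  have hi := fun i => congrFun hX i
  exact ⟨hi 0, hi 1, hi 2, hi 3, hi 4⟩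

end Decomposition

/-! ### Reduction to the five normal forms. -/

section Classification

variable {K : Type*} [Field K] {V : Type*} [AddCommGroup V] [Module K V] {Q : QuadraticForm K V}

lemma tableAnisoDim_split_even (r : ℕ) :
    tableAnisoDim ((2 * r, 1, 1) : ℕ × SquareClass K × ℤˣ) = 0 := by
  simp [tableAnisoDim]

lemma tableAnisoDim_quaternion (r : ℕ) :
    tableAnisoDim ((2 * r, 1, -1) : ℕ × SquareClass K × ℤˣ) = 4 := by
  simp [tableAnisoDim]

lemma tableAnisoDim_binary (r : ℕ) {δ : Kˣ} (hδ : ¬ IsSquare δ) (w : ℤˣ) :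
    tableAnisoDim (2 * r, sqClass δ, w) = 2 := by
  rw [← sqClass_eq_one_iff] at hδ
  simp [tableAnisoDim, hδ]

lemma tableAnisoDim_split_odd (r : ℕ) (δ : SquareClass K) :
    tableAnisoDim (2 * r + 1, δ, 1) = 1 := by
  simp [tableAnisoDim]

lemma tableAnisoDim_ternary (r : ℕ) (δ : SquareClass K) :
    tableAnisoDim (2 * r + 1, δ, -1) = 3 := by
  simp [tableAnisoDim]

lemma unary_anisotropic (a : Kˣ) : (diag ![a]).Anisotropic := by
  intro x hx
  ext i
  rw [Fin.fin_one_eq_zero i]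
  simpa [diag_apply] using hx

lemma binary_anisotropic {α δ : Kˣ} (hδ : ¬ IsSquare δ) :
    (diag ![α, -(α * δ)]).Anisotropic := by
  intro x hx
  have h : x 0 * x 0 = δ * (x 1 * x 1) := by
    simp only [diag_apply, Fin.sum_univ_two, Matrix.cons_val_zero, Matrix.cons_val_one,
      Units.val_neg, Units.val_mul] at hx
    exact mul_left_cancel₀ α.ne_zero (by linear_combination hx)
  have h1 : x 1 = 0 := by
    by_contra h1
    have h0 : x 0 ≠ 0 := fun h0 => by simp [h0, h1] at h
    refine hδ ⟨Units.mk0 _ h0 * (Units.mk0 _ h1)⁻¹, Units.ext ?_⟩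
    push_cast
    simp only [Units.val_mk0]
    field_simp
    linear_combination -h
  have h0 : x 0 = 0 := by simpa [h1] using h
  ext i
  fin_cases i
  · exact h0
  · exact h1

lemma not_isSquare_of_binary_anisotropic {a b : Kˣ} (h : (diag ![a, b]).Anisotropic) :
    ¬ IsSquare (-(b / a)) := by
  rintro ⟨s, hs⟩
  have hs' : -((b : K) / a) = s * s := by simpa using congrArg (fun u : Kˣ => (u : K)) hs
  have := h ![s, 1] (by
    simp only [diag_apply, Fin.sum_univ_two, Matrix.cons_val_zero, Matrix.cons_val_one]
    rw [← hs']
    have ha := a.ne_zero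
    field_simp
    ring)
  simpa using congrFun this 1

lemma HasGHY.hasAnisoDim {g : ℕ × SquareClass K × ℤˣ} (h : HasGHY Q g) :
    HasAnisoDim Q (tableAnisoDim g) := by
  cases h with
  | split_even r h =>
    rw [tableAnisoDim_split_even]
    exact ⟨r, 0, fun x _ => Subsingleton.elim _ _, h.trans (prod_diag_fin_zero _ _).symm⟩
  | quaternion r hr a b hD h =>
    rw [tableAnisoDim_quaternion]
    exact ⟨_, _, hD, h⟩
  | binary r hr α δ hδ h =>
    rw [tableAnisoDim_binary _ hδ]
    exact ⟨_, _, binary_anisotropic hδ, h⟩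
  | split_odd r δ h =>
    rw [tableAnisoDim_split_odd]
    exact ⟨_, _, unary_anisotropic δ, h⟩
  | ternary r hr a b δ hT h =>
    rw [tableAnisoDim_ternary]
    exact ⟨_, _, hT, h⟩

variable [NeZero (2 : K)]

/-- ⟨-1⟩ ⊕ v has dimension 5, hence is isotropic, so v represents 1. Writing v as ⟨1, b₀, b₁, b₂⟩,
the square determinant forces b₂ into the class of b₀ b₁. -/
lemma exists_quaternionNorm_equivalent (hK : IsHilbertField K) {v : Fin 4 → Kˣ}
    (hv : (diag v).Anisotropic) : ∃ a b : Kˣ, (diag v).Equivalent (quaternionNorm a b) := by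
  have h5 : ∃ x, diag v x = 1 := by
    by_contra hne
    push Not at hne
    have : (diag (Fin.cons (-1) v : Fin 5 → Kˣ)).Anisotropic := fun x hx => by
      obtain ⟨x₀, x, rfl⟩ : ∃ (x₀ : K) (x' : Fin 4 → K), x = Fin.cons x₀ x' :=
        ⟨x 0, Fin.tail x, (Fin.cons_self_tail x).symm⟩
      have hx' : diag v x = x₀ * x₀ := by
        rw [diag_apply (Fin.cons (-1) v), Fin.sum_univ_succ] at hx
        simp only [Fin.cons_zero, Fin.cons_succ, Units.val_neg, Units.val_one] at hx
        rw [diag_apply]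
        linear_combination hx
      have h0 : x₀ = 0 := by
        by_contra h0
        refine hne (x₀⁻¹ • x) ?_
        rw [QuadraticMap.map_smul, hx', smul_eq_mul]
        field_simp
      subst h0
      rw [hv x (by simpa using hx')]
      ext i
      refine Fin.cases ?_ (fun j => ?_) i <;> simp
    have := hK.le_four_of_anisotropic this
    omega
  obtain ⟨x, hx⟩ := h5
  obtain ⟨b, hb, hd, -⟩ := exists_cons hK v 1 x (by simpa using hx)
  have hsq : IsSquare (v 0 * v 1 * (v 2 * v 3)) :=
    hK.isSquare_of_quaternary_anisotropic fun x y z w h => by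
      have := hv ![x, y, z, w] (by
        simp only [diag_apply, Fin.sum_univ_four]
        rw [← h]
        simp [sq])
      have hi := fun i => congrFun this i
      exact ⟨hi 0, hi 1, hi 2, hi 3⟩
  rw [← sqClass_eq_one_iff, ← mul_assoc, ← Fin.prod_univ_four, hd, one_mul,
    Fin.prod_univ_three, sqClass_mul] at hsq
  refine ⟨-b 0, -b 1, hb.trans (diag_congr fun i => ?_)⟩
  fin_cases i
  · simp
  · simp
  · change sqClass (b 1) = sqClass (- -b 1)
    rw [neg_neg]
  · have : sqClass (b 2) = sqClass (b 0 * b 1) :=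
      mul_left_cancel (a := sqClass (b 0 * b 1)) (by rw [hsq, sqClass_mul_self])
    change sqClass (b 2) = sqClass (-b 0 * -b 1)
    rwa [neg_mul_neg]

lemma exists_hasGHY (hK : IsHilbertField K) {k m : ℕ} {v : Fin m → Kˣ}
    (hv : (diag v).Anisotropic) (h : Q.Equivalent ((hyperbolic K k).prod (diag v))) :
    ∃ g, HasGHY Q g ∧ tableAnisoDim g = m := by
  have hm := hK.le_four_of_anisotropic hv
  interval_cases m
  · exact ⟨_, .split_even k (h.trans (prod_diag_fin_zero _ _)), tableAnisoDim_split_even k⟩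
  · obtain ⟨a, rfl⟩ : ∃ a, v = ![a] := ⟨v 0, by ext i; fin_cases i; rfl⟩
    exact ⟨_, .split_odd k a h, tableAnisoDim_split_odd k _⟩
  · obtain ⟨a, b, rfl⟩ : ∃ a b, v = ![a, b] := ⟨v 0, v 1, by ext i; fin_cases i <;> rfl⟩
    have hδ := not_isSquare_of_binary_anisotropic hv
    -- The index r is half the total dimension, rounded down, so it exceeds the number k of planes
    -- by one here and in dimension 3, and by two in dimension 4.
    refine ⟨_, .binary (k + 1) (by omega) a _ hδ ?_, tableAnisoDim_binary _ hδ _⟩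
    rwa [mul_neg, neg_neg, mul_div_cancel]
  · obtain ⟨a, b, c, rfl⟩ : ∃ a b c, v = ![a, b, c] :=
      ⟨v 0, v 1, v 2, by ext i; fin_cases i <;> rfl⟩
    -- The required shape -δ⟨a', b', a'b'⟩ has -δ = ab/c, a' = c/b and b' = c/a.
    have e : ![a, b, c] = ![- -(a * b / c) * (c / b), - -(a * b / c) * (c / a),
        - -(a * b / c) * (c / b * (c / a))] := by
      rw [neg_neg]
      have ha := a.ne_zero
      have hb := b.ne_zero
      have hc := c.ne_zero
      congr 1
      · ext
        push_cast
        field_simp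
      · congr 1
        · ext
          push_cast
          field_simp
        · congr 1
          ext
          push_cast
          field_simp
    rw [e] at hv h
    exact ⟨_, .ternary (k + 1) (by omega) _ _ _ hv h, tableAnisoDim_ternary _ _⟩
  · obtain ⟨a, b, hab⟩ := exists_quaternionNorm_equivalent hK hv
    exact ⟨_, .quaternion (k + 2) (by omega) a b (Anisotropic.of_equivalent hab hv)
      (h.trans ((QuadraticMap.Equivalent.refl _).prod hab)), tableAnisoDim_quaternion _⟩

end Classification

/-! ### The table, its injectivity, and the comparison theorem. -/

section Table

variable {K : Type*} [Field K]

@[simp] lemma hasse_one (a : Kˣ) : hasse ![a] = 1 := by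
  simp [hasse]

@[simp] lemma hasse_zero (a : Fin 0 → Kˣ) : hasse a = 1 := by
  simp [hasse]

lemma hasse_three (a b c : Kˣ) :
    hasse ![a, b, c] = hilbertSymbol a b * hilbertSymbol a c * hilbertSymbol b c := by
  simp [hasse, Fin.prod_univ_succ, Fin.prod_Ioi_succ]

lemma hasse_four (a b c d : Kˣ) :
    hasse ![a, b, c, d] = hilbertSymbol a b * hilbertSymbol a c * hilbertSymbol a d *
      (hilbertSymbol b c * hilbertSymbol b d) * hilbertSymbol c d := by
  simp [hasse, Fin.prod_univ_succ, Fin.prod_Ioi_succ, mul_assoc]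

variable [NeZero (2 : K)] (hK : IsHilbertField K)
include hK

/-- Multiplying the form by c shows that anisotropy forces (-ac, -bc) = -1; bilinearity turns this
into the stated value. -/
lemma IsHilbertField.hasse_ternary_of_anisotropic {a b c : Kˣ}
    (h : (diag ![a, b, c]).Anisotropic) :
    hasse ![a, b, c] = -hilbertSymbol (-1) (-(a * b * c)) := by
  have hs : ¬ HilbertSolvable (-1 * (a * c)) (-1 * (b * c)) := by
    rintro ⟨x, y, z, hne, hxyz⟩
    have := h ![x, y, z / c] (by
      simp only [diag_apply, Fin.sum_univ_three]
      have hc := c.ne_zero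
      push_cast at hxyz
      simp
      field_simp
      linear_combination -hxyz)
    have hi := fun i => congrFun this i
    have h0 : x = 0 := hi 0
    have h1 : y = 0 := hi 1
    have h2 : z / c = 0 := hi 2
    have h2 : z = 0 := by simpa using h2
    tauto
  have hs' : hilbertSymbol (-1 * (a * c)) (-1 * (b * c)) = -1 := by
    simp only [hilbertSymbol, hs, if_false]
  rw [hasse_three, ← neg_one_mul (a * b * c)]
  simp only [hK.mul_left, hK.mul_right, hK.self_eq c, hilbertSymbol_comm a (-1),
    hilbertSymbol_comm c (-1), hilbertSymbol_comm c b] at hs' ⊢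
  generalize hilbertSymbol (-1 : Kˣ) (-1) = e at *
  generalize hilbertSymbol (-1 : Kˣ) a = p at *
  generalize hilbertSymbol (-1 : Kˣ) b = q at *
  generalize hilbertSymbol (-1 : Kˣ) c = r at *
  generalize hilbertSymbol a b = s at *
  generalize hilbertSymbol a c = t at *
  generalize hilbertSymbol b c = u at *
  revert e p q r s t u
  decide

/-- Already the subform ⟨1, -a, -b⟩ is anisotropic, so (a, b) = -1. -/
lemma IsHilbertField.hasse_quaternion_of_anisotropic {a b : Kˣ}
    (h : (quaternionNorm a b).Anisotropic) :
    hasse ![1, -a, -b, a * b] = -hilbertSymbol (-1 : Kˣ) (-1) := by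
  have hs : ¬ HilbertSolvable a b := by
    rintro ⟨x, y, z, hne, hxyz⟩
    have := h ![z, x, y, 0] (by
      simp only [quaternionNorm, diag_apply, Fin.sum_univ_four]
      simp
      linear_combination -hxyz)
    have hi := fun i => congrFun this i
    have h0 : z = 0 := hi 0
    have h1 : x = 0 := hi 1
    have h2 : y = 0 := hi 2
    tauto
  have hs' : hilbertSymbol a b = -1 := by simp [hilbertSymbol, hs]
  rw [hasse_four, ← neg_one_mul a, ← neg_one_mul b]
  simp only [hilbertSymbol_one_left, hK.mul_left, hK.mul_right, hK.self_eq a, hK.self_eq b,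
    hilbertSymbol_comm a (-1), hilbertSymbol_comm b a, hs']
  generalize hilbertSymbol (-1 : Kˣ) (-1) = e
  generalize hilbertSymbol (-1 : Kˣ) a = p
  generalize hilbertSymbol (-1 : Kˣ) b = q
  revert e p q
  decide

lemma HasGHY.hasStd_ghyToStd {V : Type*} [AddCommGroup V] [Module K V] {Q : QuadraticForm K V}
    {g : ℕ × SquareClass K × ℤˣ} (h : HasGHY Q g) : HasStd Q (ghyToStd g) := by
  have hε : hilbertClass (negOne : SquareClass K) negOne = hilbertSymbol (-1 : Kˣ) (-1) := rfl
  have odd_div : ∀ r, (2 * r + 1) / 2 = r := by omega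
  have hclass : ∀ (r : ℕ) (δ : Kˣ), hilbertClass (sqClass ((-1) ^ r)) (negOne * sqClass δ) =
    hilbertSymbol ((-1) ^ r) (-δ) := fun r δ => by
      rw [← neg_one_mul δ]
      rfl
  cases h with
  | split_even r h =>
    convert hasStd_of_hyperbolic_prod hK (v := (Fin.elim0 : Fin 0 → Kˣ))
      (h.trans (prod_diag_fin_zero _ _).symm) using 1
    simp [ghyToStd, tableHasse, hε, negOne_pow]
  | quaternion r hr a b hD h =>
    obtain ⟨r, rfl⟩ : ∃ s, r = s + 2 := ⟨r - 2, by omega⟩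
    convert hasStd_of_hyperbolic_prod hK h using 1
    have hp : ∏ i, ![1, -a, -b, a * b] i = (a * b) * (a * b) := by
      simp [Fin.prod_univ_four]
    -- The Hasse invariant -(-1, -1) of the norm form supplies the extra power of (-1, -1).
    have hd : (r + 2) / 2 = r / 2 + 1 := by omega
    rw [hp, hilbertSymbol_mul_self_right, hK.hasse_quaternion_of_anisotropic hD]
    have hev : Even (2 * (r + 2)) := even_two_mul _
    simp only [ghyToStd, tableHasse, hε, negOne_pow, hev, if_true, hd,
      Nat.mul_div_cancel_left _ two_pos]
    refine Prod.ext (by change 2 * (r + 2) = 2 * (r + 2 - 2) + 4; omega) (Prod.ext ?_ ?_)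
    · change sqClass _ * 1 = sqClass _
      rw [sqClass_mul, sqClass_mul (a * b), sqClass_mul_self, pow_add]
      simp
    · simp [pow_succ]
  | binary r hr α δ hδ h =>
    obtain ⟨r, rfl⟩ : ∃ s, r = s + 1 := ⟨r - 1, by omega⟩
    convert hasStd_of_hyperbolic_prod hK h using 1
    have hp : sqClass (∏ i, ![α, -(α * δ)] i) = sqClass (-δ) := by
      rw [eq_comm, sqClass_eq_iff]
      exact ⟨α, by simp [mul_comm, mul_left_comm]⟩
    have hev : Even (2 * (r + 1)) := even_two_mul _
    have hδ' : sqClass δ ≠ 1 := fun h => hδ (sqClass_eq_one_iff.mp h)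
    rw [hilbertSymbol_congr rfl hp, sqClass_mul, hp]
    simp only [ghyToStd, tableHasse, hε, hclass, hev, if_true, hδ', if_false, negOne_pow,
      Nat.mul_div_cancel_left _ two_pos, Nat.add_sub_cancel]
    refine Prod.ext (by ring) (Prod.ext ?_ ?_)
    · simp only
      rw [← sqClass_mul, ← sqClass_mul, pow_succ]
      simp
    · simp only
      ac_rfl
  | split_odd r δ h =>
    convert hasStd_of_hyperbolic_prod hK h using 1
    have hodd : ¬ Even (2 * r + 1) := by simp
    simp only [ghyToStd, tableHasse, hε, hodd, if_false, if_true, odd_div, negOne_pow,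
      hilbertClass_sqClass]
    simp [sqClass_mul]
  | ternary r hr a b δ hT h =>
    obtain ⟨r, rfl⟩ : ∃ s, r = s + 1 := ⟨r - 1, by omega⟩
    convert hasStd_of_hyperbolic_prod hK h using 1
    have hp : ∏ i, ![-δ * a, -δ * b, -δ * (a * b)] i = -δ * ((δ * a * b) * (δ * a * b)) := by
      rw [Fin.prod_univ_three]
      ext
      simp
      ring
    have hp' : sqClass (-(-δ * a * (-δ * b) * (-δ * (a * b)))) = sqClass δ := by
      rw [eq_comm, sqClass_eq_iff]
      refine ⟨δ * a * b, ?_⟩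
      ext
      push_cast
      ring
    have hp'' : sqClass (∏ i, ![-δ * a, -δ * b, -δ * (a * b)] i) = sqClass (-δ) := by
      rw [hp, sqClass_mul, sqClass_mul, sqClass_mul_self, mul_one]
    rw [hK.hasse_ternary_of_anisotropic hT, hilbertSymbol_congr rfl hp',
      hilbertSymbol_congr rfl hp'', sqClass_mul, hp'']
    have hodd : ¬ Even (2 * (r + 1) + 1) := by simp
    have h1 : (-1 : ℤˣ) ≠ 1 := by decide
    simp only [ghyToStd, tableHasse, hε, hclass, hodd, if_false, h1, odd_div, negOne_pow,
      Nat.add_sub_cancel]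
    refine Prod.ext (by ring) (Prod.ext ?_ ?_)
    · simp only
      rw [← sqClass_mul, ← sqClass_mul, pow_succ]
      simp
    · change _ * hilbertSymbol (-1) δ = _
      simp

omit hK [NeZero (2 : K)] in
-- Needed because at n = 1 the table values for w = 1 and w = -1 are 1 and -(-1, δ), which may
-- coincide.
lemma HasGHY.eq_one_of_dim_eq_one {V : Type*} [AddCommGroup V] [Module K V]
    {Q : QuadraticForm K V} {g : ℕ × SquareClass K × ℤˣ} (h : HasGHY Q g) (hn : g.1 = 1) :
    g.2.2 = 1 := by
  cases h with
  | split_odd => rfl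
  | split_even => rfl
  | quaternion => simp only at hn; omega
  | binary => simp only at hn; omega
  | ternary => simp only at hn; omega

lemma tableHasse_one_ne_neg_one {n : ℕ} (hn : n ≠ 1) (δ : SquareClass K) :
    tableHasse (n, δ, 1) ≠ tableHasse (n, δ, -1) := by
  have h1 : (-1 : ℤˣ) ≠ 1 := by decide
  have hne : ∀ u : ℤˣ, u ≠ -u := by decide
  obtain ⟨r, rfl | rfl⟩ := n.even_or_odd'
  · by_cases hδ : δ = 1
    · simp [tableHasse, hδ, hne]
    · simp [tableHasse, hδ, hne]
  · obtain ⟨r, rfl⟩ : ∃ s, r = s + 1 := ⟨r - 1, by omega⟩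
    obtain ⟨d, rfl⟩ := sqClass_surjective δ
    have hodd : ¬ Even (2 * (r + 1) + 1) := by simp
    have hdiv : (2 * (r + 1) + 1) / 2 = r + 1 := by omega
    simp only [tableHasse, hodd, if_false, if_true, h1, hdiv, Nat.add_sub_cancel]
    have e1 : hilbertClass (negOne ^ (r + 1)) (sqClass d) =
        hilbertSymbol ((-1) ^ r * -1) d := by rw [← pow_succ]; rfl
    have e2 : hilbertClass (negOne ^ r) (negOne * sqClass d) =
      hilbertSymbol ((-1) ^ r) (-1 * d) := rfl
    have e3 : hilbertClass negOne (sqClass d) = hilbertSymbol (-1) d := rfl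
    have e4 : hilbertClass (negOne : SquareClass K) negOne = hilbertSymbol (-1 : Kˣ) (-1) := rfl
    have e5 : hilbertSymbol ((-1 : Kˣ) ^ r) (-1) = hilbertSymbol (-1 : Kˣ) (-1) ^ r := by
      rw [hilbertSymbol_comm]
      simpa using hK.prod_right (Finset.range r) (-1) fun _ => -1
    have hparity : hilbertSymbol (-1 : Kˣ) (-1) ^ ((r + 1) / 2) =
        hilbertSymbol (-1 : Kˣ) (-1) ^ r * hilbertSymbol (-1 : Kˣ) (-1) ^ (r / 2) := by
      rw [← pow_add, show r + r / 2 = (r + 1) / 2 + 2 * (r / 2) by omega, pow_add, pow_mul,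
        Int.units_sq, one_pow, mul_one]
    rw [e1, e2, e3, e4, hK.mul_left, hK.mul_right, e5, hparity]
    convert hne _ using 1
    simp only [neg_mul, neg_inj]
    ac_rfl

lemma ghyToStd_injective_of_hasGHY {V V' : Type*} [AddCommGroup V] [Module K V]
    [AddCommGroup V'] [Module K V'] {Q : QuadraticForm K V} {Q' : QuadraticForm K V'}
    {g g' : ℕ × SquareClass K × ℤˣ} (h : HasGHY Q g) (h' : HasGHY Q' g')
    (he : ghyToStd g = ghyToStd g') : g = g' := by
  have k := h.eq_one_of_dim_eq_one
  have k' := h'.eq_one_of_dim_eq_one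
  obtain ⟨n, δ, w⟩ := g
  obtain ⟨n', δ', w'⟩ := g'
  simp only [ghyToStd, Prod.mk.injEq] at he k k'
  obtain ⟨rfl, hδ, hw⟩ := he
  obtain rfl := mul_left_cancel hδ
  have : w = w' := by
    by_cases hn : n = 1
    · rw [k hn, k' hn]
    · have hne := tableHasse_one_ne_neg_one hK hn δ
      rcases Int.units_eq_one_or w with rfl | rfl <;> rcases Int.units_eq_one_or w' with rfl | rfl
      · rfl
      · exact absurd hw hne
      · exact absurd hw.symm hne
      · rfl
  rw [this]

lemma HasGHY.unique {V : Type*} [AddCommGroup V] [Module K V] {Q : QuadraticForm K V}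
    {g g' : ℕ × SquareClass K × ℤˣ} (h : HasGHY Q g) (h' : HasGHY Q g') : g = g' :=
  ghyToStd_injective_of_hasGHY hK h h'
    ((h.hasStd_ghyToStd hK).unique hK (h'.hasStd_ghyToStd hK))

/-- An anisotropic part of dimension m puts the space in a normal form with table entry m, and the
triple is unique. -/
lemma HasGHY.hasAnisoDim_iff {V : Type*} [AddCommGroup V] [Module K V] {Q : QuadraticForm K V}
    {g : ℕ × SquareClass K × ℤˣ} (h : HasGHY Q g) (m : ℕ) :
    HasAnisoDim Q m ↔ m = tableAnisoDim g := by
  refine ⟨?_, fun hm => hm ▸ h.hasAnisoDim⟩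
  rintro ⟨k, A, hA, hQ⟩
  have : Invertible (2 : K) := invertibleOfNonzero (NeZero.ne _)
  have hdiag := exists_diag_of_separatingLeft (QuadraticMap.separatingLeft_of_anisotropic A hA)
  rw [Module.finrank_fin_fun] at hdiag
  obtain ⟨v, hv⟩ := hdiag
  obtain ⟨g', hg', rfl⟩ := exists_hasGHY hK (Anisotropic.of_equivalent hv hA)
    (hQ.trans ((QuadraticMap.Equivalent.refl _).prod hv))
  rw [hg'.unique hK h]

lemma exists_hasGHY_and_hasStd_of_nondegenerate {V : Type*} [AddCommGroup V] [Module K V]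
    [FiniteDimensional K V] {Q : QuadraticForm K V} (hQ : Q.Nondegenerate) :
    (∃ g, HasGHY Q g) ∧ ∃ s, HasStd Q s := by
  have : Invertible (2 : K) := invertibleOfNonzero (NeZero.ne _)
  obtain ⟨a, ha⟩ := exists_diag_of_separatingLeft
    (QuadraticMap.nondegenerate_associated_iff.mpr hQ).1
  obtain ⟨k, m, v, hv, hav⟩ := exists_hyperbolic_decomposition hK _ a
  obtain ⟨g, hg, -⟩ := exists_hasGHY hK hv (ha.trans hav)
  exact ⟨⟨g, hg⟩, _, hasStd_of_equivalent ha⟩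

/-- The comparison of the two systems of invariants over a Hilbert field. -/
theorem IsHilbertField.ghy_std_comparison :
    (∀ (V : Type u) [AddCommGroup V] [Module K V] [FiniteDimensional K V]
        (Q : QuadraticForm K V), Q.Nondegenerate →
      (∃! g, HasGHY Q g) ∧ (∃! s, HasStd Q s) ∧
      ∀ g, HasGHY Q g →
        HasStd Q (ghyToStd g) ∧ ∀ m, HasAnisoDim Q m ↔ m = tableAnisoDim g) ∧
    Set.BijOn ghyToStd (ghyTriples.{u} K) (stdTriples.{u} K) := by
  refine ⟨fun V _ _ _ Q hQ => ?_, ?_, ?_, ?_⟩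
  · obtain ⟨⟨g, hg⟩, s, hs⟩ := exists_hasGHY_and_hasStd_of_nondegenerate hK hQ
    exact ⟨⟨g, hg, fun g' hg' => hg'.unique hK hg⟩, ⟨s, hs, fun s' hs' => hs'.unique hK hs⟩,
      fun g hg => ⟨hg.hasStd_ghyToStd hK, hg.hasAnisoDim_iff hK⟩⟩
  · rintro g ⟨V, _, _, Q, hf, hQ, hg⟩
    exact ⟨V, _, _, Q, hf, hQ, hg.hasStd_ghyToStd hK⟩
  · rintro g ⟨V, _, _, Q, hf, hQ, hg⟩ g' ⟨V', _, _, Q', hf', hQ', hg'⟩ he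
    exact ghyToStd_injective_of_hasGHY hK hg hg' he
  · rintro s ⟨V, _, _, Q, hf, hQ, hs⟩
    obtain ⟨⟨g, hg⟩, -⟩ := exists_hasGHY_and_hasStd_of_nondegenerate hK hQ
    exact ⟨g, ⟨V, _, _, Q, hf, hQ, hg⟩, (hg.hasStd_ghyToStd hK).unique hK hs⟩

end Table

/-! ### A criterion for index two by covering with two cosets. -/

section Criterion

variable {K : Type*} [Field K] [NeZero (2 : K)]

/-- `b` lies in the norm group of `a` or in the coset of it that contains `t`. -/
def CosetCovered (a t b : Kˣ) : Prop := HilbertSolvable a b ∨ HilbertSolvable a (b * t)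

lemma CosetCovered.mul {a t b c : Kˣ} (hb : CosetCovered a t b) (hc : CosetCovered a t c) :
    CosetCovered a t (b * c) := by
  rcases hb with hb | hb <;> rcases hc with hc | hc
  · exact .inl (hb.mul hc)
  · exact .inr (by rw [mul_assoc]; exact hb.mul hc)
  · exact .inr (by rw [mul_right_comm]; exact hb.mul hc)
  · refine .inl ((hb.mul hc).congr rfl ?_)
    rw [mul_mul_mul_comm, sqClass_mul, sqClass_mul t, sqClass_mul_self, mul_one]

omit [NeZero (2 : K)] in
lemma CosetCovered.congr {a t b c : Kˣ} (h : sqClass b = sqClass c) (hb : CosetCovered a t b) :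
    CosetCovered a t c := by
  refine hb.imp (fun hb => hb.congr rfl h) fun hb => hb.congr rfl ?_
  rw [sqClass_mul, h, sqClass_mul]

omit [NeZero (2 : K)] in
lemma CosetCovered.one (a t : Kˣ) : CosetCovered a t 1 :=
  .inl (.of_isSquare (.one))

omit [NeZero (2 : K)] in
lemma CosetCovered.self (a t : Kˣ) : CosetCovered a t t :=
  .inr (hilbertSolvable_mul_self a t)

lemma isHilbertField_of_cosets
    (h : ∀ a : Kˣ, ¬ IsSquare a → ∃ t, ¬ HilbertSolvable a t ∧ ∀ b, CosetCovered a t b)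
    (h' : ∃ c : Kˣ, HilbertSolvable (-1) c ∧ ¬ IsSquare c) : IsHilbertField K where
  mul_of_not a b c hb hc := by
    have ha : ¬ IsSquare a := fun ha => hb (HilbertSolvable.of_isSquare ha).comm
    obtain ⟨t, -, ht⟩ := h a ha
    refine (((ht b).resolve_left hb).mul ((ht c).resolve_left hc)).congr rfl ?_
    rw [mul_mul_mul_comm, sqClass_mul, sqClass_mul t, sqClass_mul_self, mul_one]
  exists_not a ha := by
    obtain ⟨t, ht, -⟩ := h a ha
    exact ⟨t, ht⟩
  exists_sum_two_squares := h'

end Criterion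

/-! ### Square classes, primitive solutions and Hensel's lemma in ℚ_p. -/

section Padic

variable {p : ℕ} [hp : Fact p.Prime]

/-- The inclusion of the `p`-adic units in `ℚ_pˣ`. -/
def ofUnit : ℤ_[p]ˣ →* ℚ_[p]ˣ := Units.map (PadicInt.Coe.ringHom : ℤ_[p] →+* ℚ_[p])

@[simp] lemma val_ofUnit (u : ℤ_[p]ˣ) : (ofUnit u : ℚ_[p]) = ((u : ℤ_[p]) : ℚ_[p]) := rfl

/-- The uniformizer `p` of `ℚ_p`. -/
def unif (p : ℕ) [hp : Fact p.Prime] : ℚ_[p]ˣ :=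
  Units.mk0 (p : ℚ_[p]) (Nat.cast_ne_zero.mpr hp.out.ne_zero)

@[simp] lemma val_unif : (unif p : ℚ_[p]) = p := rfl

lemma exists_ofUnit_eq {b : ℚ_[p]ˣ} (hb : ‖(b : ℚ_[p])‖ = 1) : ∃ u, ofUnit u = b :=
  ⟨PadicInt.mkUnits hb, Units.ext rfl⟩

lemma exists_sqClass_eq (a : ℚ_[p]ˣ) :
    ∃ u : ℤ_[p]ˣ, sqClass a = sqClass (ofUnit u) ∨ sqClass a = sqClass (ofUnit u * unif p) := by
  have hp0 : (p : ℝ) ≠ 0 := Nat.cast_ne_zero.mpr hp.out.ne_zero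
  have ha := Padic.norm_eq_zpow_neg_valuation a.ne_zero
  obtain ⟨k, hk | hk⟩ := Int.even_or_odd' (a : ℚ_[p]).valuation
  · obtain ⟨u, hu⟩ := exists_ofUnit_eq (b := a * (unif p ^ (-k) * unif p ^ (-k))) (by
      push_cast
      rw [norm_mul, norm_mul, ha, hk, val_unif, norm_zpow, Padic.norm_p, inv_zpow', neg_neg,
        ← zpow_add₀ hp0, ← zpow_add₀ hp0, show -(2 * k) + (k + k) = 0 by ring, zpow_zero])
    exact ⟨u, .inl (sqClass_eq_iff.mpr ⟨_, hu⟩)⟩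
  · obtain ⟨u, hu⟩ := exists_ofUnit_eq (b := a * (unif p ^ (-k) * unif p ^ (-k)) * (unif p)⁻¹) (by
      push_cast
      rw [norm_mul, norm_mul, norm_mul, ha, hk, val_unif, norm_zpow, norm_inv, Padic.norm_p,
        inv_zpow', neg_neg, inv_inv, ← zpow_add₀ hp0, ← zpow_add₀ hp0, ← zpow_add_one₀ hp0,
        show -(2 * k + 1) + (k + k) + 1 = 0 by ring, zpow_zero])
    refine ⟨u, .inr (sqClass_eq_iff.mpr ⟨unif p ^ (-k), ?_⟩)⟩
    rw [hu, inv_mul_cancel_right]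

/-- Division by a coordinate of largest norm makes the solution integral with one coordinate equal
to 1, ready for reduction mod p or mod 8. -/
lemma HilbertSolvable.exists_primitive {a b : ℚ_[p]ˣ} {A B : ℤ_[p]} (ha : (a : ℚ_[p]) = A)
    (hb : (b : ℚ_[p]) = B) (h : HilbertSolvable a b) :
    ∃ x y z : ℤ_[p], (x = 1 ∨ y = 1 ∨ z = 1) ∧ A * x ^ 2 + B * y ^ 2 = z ^ 2 := by
  obtain ⟨x, y, z, hne, h⟩ := h
  rw [ha, hb] at h
  have key : ∀ w : ℚ_[p], w ≠ 0 → ‖x‖ ≤ ‖w‖ → ‖y‖ ≤ ‖w‖ → ‖z‖ ≤ ‖w‖ → (w = x ∨ w = y ∨ w = z) →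
      ∃ x y z : ℤ_[p], (x = 1 ∨ y = 1 ∨ z = 1) ∧ A * x ^ 2 + B * y ^ 2 = z ^ 2 := by
    intro w hw hx hy hz hor
    have hn : ∀ v : ℚ_[p], ‖v‖ ≤ ‖w‖ → ∃ v' : ℤ_[p], (v' : ℚ_[p]) = v / w := fun v hv => by
      refine ⟨⟨v / w, ?_⟩, rfl⟩
      rw [norm_div]
      exact div_le_one_of_le₀ hv (norm_nonneg _)
    obtain ⟨x', hx'⟩ := hn x hx
    obtain ⟨y', hy'⟩ := hn y hy
    obtain ⟨z', hz'⟩ := hn z hz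
    refine ⟨x', y', z', ?_, ?_⟩
    · refine hor.imp (fun h => ?_) (Or.imp (fun h => ?_) fun h => ?_)
      all_goals
        subst h
        apply Subtype.ext
        first
        | exact hx'.trans (div_self hw)
        | exact hy'.trans (div_self hw)
        | exact hz'.trans (div_self hw)
    · apply Subtype.ext
      push_cast
      rw [hx', hy', hz']
      field_simp
      linear_combination h
  have hx0 : ‖y‖ ≤ ‖x‖ → ‖z‖ ≤ ‖x‖ → x ≠ 0 := by
    rintro hy hz rfl
    simp_all
  have hy0 : ‖x‖ ≤ ‖y‖ → ‖z‖ ≤ ‖y‖ → y ≠ 0 := by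
    rintro hx hz rfl
    simp_all
  have hz0 : ‖x‖ ≤ ‖z‖ → ‖y‖ ≤ ‖z‖ → z ≠ 0 := by
    rintro hx hy rfl
    simp_all
  rcases le_total ‖x‖ ‖y‖ with hxy | hxy
  · rcases le_total ‖y‖ ‖z‖ with hyz | hyz
    · exact key z (hz0 (hxy.trans hyz) hyz) (hxy.trans hyz) hyz le_rfl (by simp)
    · exact key y (hy0 hxy hyz) hxy le_rfl hyz (by simp)
  · rcases le_total ‖x‖ ‖z‖ with hxz | hxz
    · exact key z (hz0 hxz (hxy.trans hxz)) hxz (hxy.trans hxz) le_rfl (by simp)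
    · exact key x (hx0 hxy hxz) le_rfl hxy hxz (by simp)

lemma exists_sq_eq_of_norm_lt {u x : ℤ_[p]} (h : ‖x ^ 2 - u‖ < ‖2 * x‖ ^ 2) :
    ∃ z : ℤ_[p], z ^ 2 = u := by
  have hF : (Polynomial.X ^ 2 - Polynomial.C u).aeval x = x ^ 2 - u := by simp
  have hF' : (Polynomial.X ^ 2 - Polynomial.C u).derivative.aeval x = 2 * x := by
    rw [Polynomial.derivative_sub, Polynomial.derivative_C, sub_zero, Polynomial.derivative_X_sq]
    simp
  obtain ⟨z, hz, -⟩ := hensels_lemma (R := ℤ_[p])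
    (F := Polynomial.X ^ 2 - Polynomial.C u) (a := x) (by rwa [hF, hF'])
  exact ⟨z, by simpa [sub_eq_zero] using hz⟩

lemma isSquare_ofUnit {u : ℤ_[p]ˣ} {z : ℤ_[p]} (h : z ^ 2 = u) : IsSquare (ofUnit u) := by
  have hz : IsUnit z := by
    refine isUnit_of_mul_isUnit_left (y := z) ?_
    rw [← sq, h]
    exact u.isUnit
  obtain ⟨z, rfl⟩ := hz
  refine ⟨ofUnit z, ?_⟩
  rw [← map_mul]
  congr 1
  ext1
  rw [← h, sq, Units.val_mul]

/-- Otherwise p, a sum of four squares by Lagrange, would itself be a square, although its valuation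
is odd. -/
lemma exists_sum_two_squares_not_isSquare :
    ∃ c : ℚ_[p]ˣ, HilbertSolvable (-1) c ∧ ¬ IsSquare c := by
  by_contra! hne
  have key : ∀ x y : ℚ_[p], ∃ z, x ^ 2 + y ^ 2 = z ^ 2 := fun x y => by
    by_cases h0 : x ^ 2 + y ^ 2 = 0
    · exact ⟨0, by rw [h0]; simp⟩
    obtain ⟨s, hs⟩ := hne (Units.mk0 _ h0) (hilbertSolvable_of_eq x y (by simp))
    refine ⟨s, ?_⟩
    simpa [sq] using congrArg (fun u : ℚ_[p]ˣ => (u : ℚ_[p])) hs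
  obtain ⟨a, b, c, d, h⟩ := Nat.sum_four_squares p
  have h' : (p : ℚ_[p]) = a ^ 2 + b ^ 2 + (c ^ 2 + d ^ 2) := by
    rw [← add_assoc]
    exact_mod_cast h.symm
  obtain ⟨x, hx⟩ := key a b
  obtain ⟨y, hy⟩ := key c d
  obtain ⟨z, hz⟩ := key x y
  rw [hx, hy, hz] at h'
  have hv := congrArg Padic.valuation h'
  rw [Padic.valuation_p, Padic.valuation_pow] at hv
  push_cast at hv
  omega

end Padic

/-! ### Odd p. -/

section OddPrime

variable {p : ℕ} [hp : Fact p.Prime]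

lemma toZMod_eq_zero_iff {x : ℤ_[p]} : PadicInt.toZMod x = 0 ↔ ‖x‖ < 1 := by
  rw [← RingHom.mem_ker, PadicInt.ker_toZMod, PadicInt.maximalIdeal_eq_span_p,
    Ideal.mem_span_singleton, PadicInt.norm_lt_one_iff_dvd]

lemma toZMod_unit_ne_zero (u : ℤ_[p]ˣ) : PadicInt.toZMod (u : ℤ_[p]) ≠ 0 := by
  rw [Ne, toZMod_eq_zero_iff, PadicInt.norm_units]
  exact lt_irrefl _

lemma exists_toZMod_eq (x : ZMod p) : ∃ y : ℤ_[p], PadicInt.toZMod y = x :=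
  ⟨x.val, by simp⟩

lemma exists_unit_toZMod_eq {x : ZMod p} (hx : x ≠ 0) :
    ∃ u : ℤ_[p]ˣ, PadicInt.toZMod (u : ℤ_[p]) = x := by
  obtain ⟨y, rfl⟩ := exists_toZMod_eq x
  rw [Ne, toZMod_eq_zero_iff, ← PadicInt.not_isUnit_iff, not_not] at hx
  obtain ⟨u, rfl⟩ := hx
  exact ⟨u, rfl⟩

lemma isSquare_ofUnit_iff (hp2 : p ≠ 2) (u : ℤ_[p]ˣ) :
    IsSquare (ofUnit u) ↔ IsSquare (PadicInt.toZMod (u : ℤ_[p])) := by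
  constructor
  · rintro ⟨s, hs⟩
    have hs' : ((u : ℤ_[p]) : ℚ_[p]) = s * s := congrArg (fun u : ℚ_[p]ˣ => (u : ℚ_[p])) hs
    have hn : ‖(s : ℚ_[p])‖ ≤ 1 := by
      have : ‖(s : ℚ_[p])‖ * ‖(s : ℚ_[p])‖ = 1 := by
        rw [← norm_mul, ← hs', ← PadicInt.norm_def, PadicInt.norm_units]
      nlinarith [norm_nonneg (s : ℚ_[p])]
    obtain ⟨t, ht⟩ : ∃ t : ℤ_[p], (t : ℚ_[p]) = s := ⟨⟨s, hn⟩, rfl⟩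
    refine ⟨PadicInt.toZMod t, ?_⟩
    rw [← map_mul]
    congr 1
    apply Subtype.ext
    push_cast
    rw [ht]
    exact hs'
  · rintro ⟨x, hx⟩
    obtain ⟨y, rfl⟩ := exists_toZMod_eq x
    have hy : ‖y‖ = 1 := by
      rw [← PadicInt.isUnit_iff]
      by_contra hy
      rw [PadicInt.not_isUnit_iff, ← toZMod_eq_zero_iff] at hy
      exact toZMod_unit_ne_zero u (by rw [hx, hy, zero_mul])
    have h2 : ‖(2 : ℤ_[p])‖ = 1 := by
      rw [← PadicInt.isUnit_iff]
      by_contra h2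
      rw [PadicInt.not_isUnit_iff] at h2
      have h2' : ‖((2 : ℤ) : ℤ_[p])‖ < 1 := by exact_mod_cast h2
      rw [PadicInt.norm_int_lt_one_iff_dvd] at h2'
      exact hp2 ((Nat.prime_dvd_prime_iff_eq hp.out Nat.prime_two).mp (by exact_mod_cast h2'))
    obtain ⟨z, hz⟩ := exists_sq_eq_of_norm_lt (u := (u : ℤ_[p])) (x := y) (by
      rw [norm_mul, h2, hy, one_mul, one_pow, ← toZMod_eq_zero_iff, map_sub, hx, map_pow, sq,
        sub_self])
    exact isSquare_ofUnit hz

/-- Write u mod p as x² + y² and lift. The lifted sum w is congruent to u, so u w = u x² + u y² is a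
square. -/
lemma hilbertSolvable_ofUnit_self (hp2 : p ≠ 2) (u : ℤ_[p]ˣ) :
    HilbertSolvable (ofUnit u) (ofUnit u) := by
  obtain ⟨x, y, hxy⟩ := ZMod.sq_add_sq p (PadicInt.toZMod (u : ℤ_[p]))
  obtain ⟨x, rfl⟩ := exists_toZMod_eq x
  obtain ⟨y, rfl⟩ := exists_toZMod_eq y
  have hw : IsUnit (x ^ 2 + y ^ 2) := by
    by_contra hw
    rw [PadicInt.not_isUnit_iff, ← toZMod_eq_zero_iff, map_add, map_pow, map_pow, hxy] at hw
    exact toZMod_unit_ne_zero u hw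
  obtain ⟨w, hw⟩ := hw
  have hsq : IsSquare (ofUnit (u * w)) := by
    rw [isSquare_ofUnit_iff hp2]
    refine ⟨PadicInt.toZMod (u : ℤ_[p]), ?_⟩
    rw [Units.val_mul, hw, map_mul, map_add, map_pow, map_pow, hxy]
  obtain ⟨s, hs⟩ := hsq
  have hs' : ((u : ℤ_[p]) : ℚ_[p]) * ((w : ℤ_[p]) : ℚ_[p]) = s * s :=
    by simpa using congrArg (fun u : ℚ_[p]ˣ => (u : ℚ_[p])) hs
  refine ⟨x, y, s, by simp, ?_⟩
  have hw' : ((w : ℤ_[p]) : ℚ_[p]) = x ^ 2 + y ^ 2 := by rw [hw]; push_cast; rfl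
  rw [hw'] at hs'
  simp only [val_ofUnit]
  linear_combination hs'

lemma isSquare_ofUnit_mul (hp2 : p ≠ 2) {u v : ℤ_[p]ˣ} (hu : ¬ IsSquare (ofUnit u))
    (hv : ¬ IsSquare (ofUnit v)) : IsSquare (ofUnit u * ofUnit v) := by
  have hchar : ringChar (ZMod p) ≠ 2 := by rwa [ZMod.ringChar_zmod_n]
  rw [← map_mul, isSquare_ofUnit_iff hp2, Units.val_mul, map_mul,
    ← quadraticChar_one_iff_isSquare
      (mul_ne_zero (toZMod_unit_ne_zero u) (toZMod_unit_ne_zero v)), map_mul]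
  rw [isSquare_ofUnit_iff hp2, ← quadraticChar_neg_one_iff_not_isSquare] at hu hv
  rw [hu, hv]
  norm_num

lemma hilbertSolvable_ofUnit (hp2 : p ≠ 2) (u v : ℤ_[p]ˣ) :
    HilbertSolvable (ofUnit u) (ofUnit v) := by
  by_cases hu : IsSquare (ofUnit u)
  · exact (HilbertSolvable.of_isSquare hu).comm
  by_cases hv : IsSquare (ofUnit v)
  · exact HilbertSolvable.of_isSquare hv
  exact (hilbertSolvable_ofUnit_self hp2 u).of_mul_left
    (.of_isSquare (isSquare_ofUnit_mul hp2 hu hv))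

/-- Modulo p a solution gives u x² = z², forcing p to divide x and z; then y = 1 and p divides the
unit v. -/
lemma not_hilbertSolvable_ofUnit_unif (hp2 : p ≠ 2) {u : ℤ_[p]ˣ} (hu : ¬ IsSquare (ofUnit u))
    (v : ℤ_[p]ˣ) : ¬ HilbertSolvable (ofUnit u) (ofUnit v * unif p) := by
  intro h
  obtain ⟨x, y, z, hne, h⟩ := h.exists_primitive (A := u) (B := (v : ℤ_[p]) * (p : ℤ_[p])) rfl (by simp)
  rw [isSquare_ofUnit_iff hp2] at hu
  have hmod := congrArg PadicInt.toZMod h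
  simp only [map_add, map_mul, map_pow, map_natCast, CharP.cast_eq_zero, mul_zero, zero_mul,
    add_zero] at hmod
  have hx : PadicInt.toZMod x = 0 := by
    by_contra hx
    refine hu ⟨PadicInt.toZMod z / PadicInt.toZMod x, ?_⟩
    field_simp
    exact hmod
  have hz : PadicInt.toZMod z = 0 := by
    rw [hx] at hmod
    simpa using hmod.symm
  have hx1 : x ≠ 1 := by rintro rfl; simp at hx
  have hz1 : z ≠ 1 := by rintro rfl; simp at hz
  obtain rfl : y = 1 := by tauto
  rw [toZMod_eq_zero_iff, PadicInt.norm_lt_one_iff_dvd] at hx hz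
  obtain ⟨x, rfl⟩ := hx
  obtain ⟨z, rfl⟩ := hz
  have hp0 : (p : ℤ_[p]) ≠ 0 := Nat.cast_ne_zero.mpr hp.out.ne_zero
  have hv : (v : ℤ_[p]) = p * (z ^ 2 - u * x ^ 2) :=
    mul_left_cancel₀ hp0 (by linear_combination h)
  have : PadicInt.toZMod (v : ℤ_[p]) = 0 := by rw [hv]; simp
  exact toZMod_unit_ne_zero v this

lemma isHilbertField_padic_of_ne_two (hp2 : p ≠ 2) : IsHilbertField ℚ_[p] := by
  refine isHilbertField_of_cosets (fun a ha => ?_) exists_sum_two_squares_not_isSquare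
  obtain ⟨u, hu | hu⟩ := exists_sqClass_eq a
  · have hu' : ¬ IsSquare (ofUnit u) := by
      rwa [← sqClass_eq_one_iff, ← hu, sqClass_eq_one_iff]
    refine ⟨unif p, fun h => not_hilbertSolvable_ofUnit_unif hp2 hu' 1 ?_, fun b => ?_⟩
    · rw [map_one, one_mul]
      exact h.congr hu rfl
    · obtain ⟨v, hv | hv⟩ := exists_sqClass_eq b
      · exact .inl ((hilbertSolvable_ofUnit hp2 u v).congr hu.symm hv.symm)
      · refine .inr ((hilbertSolvable_ofUnit hp2 u v).congr hu.symm ?_)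
        rw [sqClass_mul, hv, sqClass_mul, mul_assoc, sqClass_mul_self, mul_one]
  · obtain ⟨x, hx⟩ := FiniteField.exists_nonsquare (F := ZMod p) (by rwa [ZMod.ringChar_zmod_n])
    obtain ⟨e, rfl⟩ := exists_unit_toZMod_eq (x := x) (by rintro rfl; exact hx (.zero))
    rw [← isSquare_ofUnit_iff hp2] at hx
    have cover : ∀ v : ℤ_[p]ˣ, CosetCovered a (ofUnit e) (ofUnit v) := fun v => by
      by_cases hv : IsSquare (ofUnit v)
      · exact .inl (.of_isSquare hv)
      · exact .inr (.of_isSquare (isSquare_ofUnit_mul hp2 hv hx))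
    refine ⟨ofUnit e, fun h => ?_, fun b => ?_⟩
    · exact not_hilbertSolvable_ofUnit_unif hp2 hx u (h.comm.congr rfl hu)
    · obtain ⟨v, hv | hv⟩ := exists_sqClass_eq b
      · exact (cover v).congr hv.symm
      -- Since -a is a norm from K(√a) and has odd valuation, multiplying by it reduces b of odd
      -- valuation to a unit.
      · have h1 : CosetCovered a (ofUnit e) (-a) := .inl (hilbertSolvable_neg_self a)
        refine (h1.mul (cover (-(u * v)))).congr ?_
        have h2 : ofUnit (-(u * v)) = -(ofUnit u * ofUnit v) := by
          ext
          simp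
        rw [h2, neg_mul_neg, hv, sqClass_mul, hu]
        simp only [sqClass_mul]
        calc _ = sqClass (ofUnit u) * sqClass (ofUnit u) *
              (sqClass (ofUnit v) * sqClass (unif p)) := by ac_rfl
          _ = _ := by rw [sqClass_mul_self, one_mul]

end OddPrime

/-! ### The prime 2. -/

section Two

/-- Hensel at x = 1: the error is at most 1/8, below |2|² = 1/4. -/
lemma isSquare_ofUnit_of_toZModPow {u : ℤ_[2]ˣ} (h : PadicInt.toZModPow 3 (u : ℤ_[2]) = 1) :
    IsSquare (ofUnit u) := by
  have hmem : (u : ℤ_[2]) - 1 ∈ Ideal.span {((2 : ℕ) : ℤ_[2]) ^ 3} := by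
    rw [← PadicInt.ker_toZModPow, RingHom.mem_ker, map_sub, h, map_one, sub_self]
  rw [← PadicInt.norm_le_pow_iff_mem_span_pow] at hmem
  have h2 : ‖(2 : ℤ_[2])‖ = 2⁻¹ := by simpa using PadicInt.norm_p (p := 2)
  obtain ⟨z, hz⟩ := exists_sq_eq_of_norm_lt (u := (u : ℤ_[2])) (x := 1) (by
    rw [one_pow, norm_sub_rev, mul_one, h2]
    refine hmem.trans_lt ?_
    norm_num)
  exact isSquare_ofUnit hz

/-- The element `5` of `ℚ_2ˣ`. -/
def five : ℚ_[2]ˣ := Units.mk0 5 (by norm_num)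

/-- The element `2` of `ℚ_2ˣ`. -/
def two : ℚ_[2]ˣ := Units.mk0 2 (by norm_num)

@[simp] lemma val_five : (five : ℚ_[2]) = 5 := rfl

@[simp] lemma val_two : (two : ℚ_[2]) = 2 := rfl

lemma exists_ofUnit_eq_intCast (n : ℤ) (hn : ¬ (2 : ℤ) ∣ n) :
    ∃ u : ℤ_[2]ˣ, (u : ℤ_[2]) = n := by
  have : IsUnit (n : ℤ_[2]) := by
    by_contra h
    rw [PadicInt.not_isUnit_iff, PadicInt.norm_int_lt_one_iff_dvd] at h
    exact hn h
  obtain ⟨u, hu⟩ := this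
  exact ⟨u, hu⟩

lemma sqClass_eq_of_toZModPow {a : ℚ_[2]ˣ} {u : ℤ_[2]ˣ} (n : ℤ) (hn : ¬ (2 : ℤ) ∣ n)
    (ha : (a : ℚ_[2]) = n) (h : (n : ZMod (2 ^ 3)) * PadicInt.toZModPow 3 (u : ℤ_[2]) = 1) :
    sqClass (ofUnit u) = sqClass a := by
  obtain ⟨v, hv⟩ := exists_ofUnit_eq_intCast n hn
  have hva : ofUnit v = a := by
    ext
    rw [val_ofUnit, hv, ha]
    push_cast
    rfl
  have := isSquare_ofUnit_of_toZModPow (u := v * u) (by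
    rw [Units.val_mul, map_mul, hv, map_intCast, h])
  rw [← sqClass_eq_one_iff, map_mul, hva, sqClass_mul] at this
  exact mul_left_cancel (this.trans (sqClass_mul_self a).symm)

lemma sqClass_ofUnit_two (u : ℤ_[2]ˣ) :
    ∃ e f : ℚ_[2]ˣ, (e = 1 ∨ e = -1) ∧ (f = 1 ∨ f = five) ∧
      sqClass (ofUnit u) = sqClass (e * f) := by
  have hu : PadicInt.toZModPow 3 (u : ℤ_[2]) *
      PadicInt.toZModPow 3 ((u⁻¹ : ℤ_[2]ˣ) : ℤ_[2]) = 1 := by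
    rw [← map_mul, Units.mul_inv, map_one]
  -- The units mod 8 are ±1 and ±5, so one of these multiplies u to 1 mod 8.
  have key : ∀ x y : ZMod (2 ^ 3), x * y = 1 → ((1 : ℤ) : ZMod (2 ^ 3)) * x = 1 ∨
      ((-1 : ℤ) : ZMod (2 ^ 3)) * x = 1 ∨ ((5 : ℤ) : ZMod (2 ^ 3)) * x = 1 ∨
      ((-5 : ℤ) : ZMod (2 ^ 3)) * x = 1 := by decide
  rcases key _ _ hu with h | h | h | h
  · exact ⟨1, 1, .inl rfl, .inl rfl, sqClass_eq_of_toZModPow 1 (by decide) (by simp) h⟩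
  · exact ⟨-1, 1, .inr rfl, .inl rfl, sqClass_eq_of_toZModPow (-1) (by decide) (by simp) h⟩
  · exact ⟨1, five, .inl rfl, .inr rfl, sqClass_eq_of_toZModPow 5 (by decide) (by simp) h⟩
  · exact ⟨-1, five, .inr rfl, .inr rfl, sqClass_eq_of_toZModPow (-5) (by decide) (by simp) h⟩

lemma exists_sqClass_two_eq (a : ℚ_[2]ˣ) :
    ∃ e f g : ℚ_[2]ˣ, (e = 1 ∨ e = -1) ∧ (f = 1 ∨ f = five) ∧ (g = 1 ∨ g = two) ∧
      sqClass a = sqClass (e * f * g) := by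
  have h2 : unif 2 = two := Units.ext (by simp)
  obtain ⟨u, hu⟩ := exists_sqClass_eq a
  obtain ⟨e, f, he, hf, h⟩ := sqClass_ofUnit_two u
  rcases hu with hu | hu
  · exact ⟨e, f, 1, he, hf, .inl rfl, by rw [hu, h, mul_one]⟩
  · exact ⟨e, f, two, he, hf, .inr rfl, by rw [hu, sqClass_mul, h, h2, sqClass_mul (e * f)]⟩

lemma not_hilbertSolvable_five_two : ¬ HilbertSolvable five two := by
  intro h
  obtain ⟨x, y, z, hne, h⟩ := h.exists_primitive (A := 5) (B := 2) rfl rfl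
  have key : ∀ x y z : ZMod (2 ^ 3), (x = 1 ∨ y = 1 ∨ z = 1) → 5 * x ^ 2 + 2 * y ^ 2 ≠ z ^ 2 := by
    decide
  refine key (PadicInt.toZModPow 3 x) (PadicInt.toZModPow 3 y) (PadicInt.toZModPow 3 z) ?_ ?_
  · refine hne.imp ?_ (Or.imp ?_ ?_) <;>
    · rintro rfl
      exact map_one _
  · simpa only [map_add, map_mul, map_pow, map_ofNat] using congrArg (PadicInt.toZModPow 3) h

lemma not_hilbertSolvable_neg_one_neg_one : ¬ HilbertSolvable (-1 : ℚ_[2]ˣ) (-1) := by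
  intro h
  obtain ⟨x, y, z, hne, h⟩ := h.exists_primitive (A := -1) (B := -1) (by simp) (by simp)
  have key : ∀ x y z : ZMod (2 ^ 3), (x = 1 ∨ y = 1 ∨ z = 1) →
      -1 * x ^ 2 + -1 * y ^ 2 ≠ z ^ 2 := by
    decide
  refine key (PadicInt.toZModPow 3 x) (PadicInt.toZModPow 3 y) (PadicInt.toZModPow 3 z) ?_ ?_
  · refine hne.imp ?_ (Or.imp ?_ ?_) <;>
    · rintro rfl
      exact map_one _
  · simpa using congrArg (PadicInt.toZModPow 3) h

lemma exists_sq_eq_neg_seven : ∃ s : ℚ_[2], s ^ 2 = -7 := by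
  obtain ⟨u, hu⟩ := exists_ofUnit_eq_intCast (-7) (by decide)
  obtain ⟨s, hs⟩ := isSquare_ofUnit_of_toZModPow (u := u) (by
    rw [hu, map_intCast]
    decide)
  refine ⟨s, ?_⟩
  have := congrArg (fun u : ℚ_[2]ˣ => (u : ℚ_[2])) hs
  simp only [val_ofUnit, hu, Units.val_mul] at this
  rw [sq, ← this]
  push_cast
  rfl

lemma cosetCovered_of_generators {a t : ℚ_[2]ˣ} (h1 : CosetCovered a t (-1))
    (h5 : CosetCovered a t five) (h2 : CosetCovered a t two) (b : ℚ_[2]ˣ) :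
    CosetCovered a t b := by
  obtain ⟨e, f, g, he, hf, hg, h⟩ := exists_sqClass_two_eq b
  refine CosetCovered.congr h.symm ((CosetCovered.mul ?_ ?_).mul ?_)
  · rcases he with rfl | rfl
    exacts [.one _ _, h1]
  · rcases hf with rfl | rfl
    exacts [.one _ _, h5]
  · rcases hg with rfl | rfl
    exacts [.one _ _, h2]

lemma isHilbertField_padic_two : IsHilbertField ℚ_[2] := by
  refine isHilbertField_of_cosets (fun a ha => ?_) exists_sum_two_squares_not_isSquare
  obtain ⟨s, hs⟩ := exists_sq_eq_neg_seven
  have n52 := not_hilbertSolvable_five_two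
  have n11 := not_hilbertSolvable_neg_one_neg_one
  have h15 : HilbertSolvable (-1) five := hilbertSolvable_of_eq 2 1 (by norm_num)
  have h12 : HilbertSolvable (-1) two := hilbertSolvable_of_eq 1 1 (by norm_num)
  have neg : ∀ b : ℚ_[2]ˣ, b * -1 = -b := fun b => by simp
  -- As 2, 5 and 10 are norms for -1, this makes t = -1 a non-norm for -2, -5 and -10.
  have n1 : ∀ b : ℚ_[2]ˣ, HilbertSolvable (-1) b → ¬ HilbertSolvable (-b) (-1) := fun b hb h =>
    n11 (hb.of_mul_left (by rw [neg]; exact h.comm))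
  obtain ⟨e, f, g, he, hf, hg, h⟩ := exists_sqClass_two_eq a
  suffices H : ∃ t, ¬ HilbertSolvable (e * f * g) t ∧ ∀ b, CosetCovered (e * f * g) t b by
    obtain ⟨t, ht, hb⟩ := H
    exact ⟨t, fun h' => ht (h'.congr h rfl),
      fun b => (hb b).imp (fun h' => h'.congr h.symm rfl) fun h' => h'.congr h.symm rfl⟩
  rw [← sqClass_eq_one_iff, h, sqClass_eq_one_iff] at ha
  rcases he with rfl | rfl <;> rcases hf with rfl | rfl <;> rcases hg with rfl | rfl <;>
    simp only [one_mul, mul_one, neg_mul] at ha ⊢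
  · exact absurd .one ha
  · have h1 : HilbertSolvable two (-1) := hilbertSolvable_of_eq 1 1 (by norm_num)
    exact ⟨five, fun h => n52 h.comm, cosetCovered_of_generators (.inl h1) (.self _ _)
      (.inl (hilbertSolvable_of_eq 2 1 (by norm_num)))⟩
  · exact ⟨two, n52, cosetCovered_of_generators (.inl h15.comm)
      (.inl (hilbertSolvable_of_eq 5 2 (by norm_num))) (.self _ _)⟩
  · refine ⟨five, fun h => n52 ?_, cosetCovered_of_generators
      (.inl (hilbertSolvable_of_eq 3 1 (by norm_num))) (.self _ _) ?_⟩
    · exact HilbertSolvable.of_mul_left (hilbertSolvable_of_eq 5 2 (by norm_num)) h.comm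
    · refine .inr (hilbertSolvable_of_eq 10 3 (by norm_num))
  · exact ⟨-1, n11, cosetCovered_of_generators (.self _ _) (.inl h15) (.inl h12)⟩
  · refine ⟨-1, n1 _ h12, cosetCovered_of_generators (.self _ _) (.inr ?_) (.inl ?_)⟩
    · exact ⟨1, 1, s, by simp, by simp [hs]; norm_num⟩
    · simpa using hilbertSolvable_neg_self (-two)
  · refine ⟨-1, n1 _ h15, cosetCovered_of_generators (.self _ _) (.inl ?_) (.inr ?_)⟩
    · simpa using hilbertSolvable_neg_self (-five)
    · exact ⟨1, 1, s, by simp, by simp [hs]; norm_num⟩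
  · have h10 : HilbertSolvable (-(five * two)) (five * two) := by
      simpa using hilbertSolvable_neg_self (-(five * two))
    have h2 : HilbertSolvable (-(five * two)) (two * -1) :=
      -- -10 · 1² - 2 · 3² = -28 = (2s)², with s² = -7.
      ⟨1, 3, 2 * s, by simp, by simp [mul_pow, hs]; norm_num⟩
    refine ⟨-1, n1 _ (h15.mul h12), cosetCovered_of_generators (.self _ _) (.inr ?_) (.inr h2)⟩
    -- The product 10 · (-2) = -20 lies in the class of -5.
    refine (h10.mul h2).congr rfl ?_
    rw [mul_mul_mul_comm, ← mul_assoc, mul_right_comm]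
    exact (sqClass_eq_iff.mpr ⟨two, by ac_rfl⟩).symm

end Two

lemma isHilbertField_padic (p : ℕ) [hp : Fact p.Prime] : IsHilbertField ℚ_[p] := by
  by_cases h : p = 2
  · subst h
    exact isHilbertField_padic_two
  · exact isHilbertField_padic_of_ne_two h

end

end LocalQuadratic

theorem mainTheorem7 (p : ℕ) [Fact p.Prime] :
    (∀ (V : Type u) [AddCommGroup V] [Module ℚ_[p] V] [FiniteDimensional ℚ_[p] V]
        (Q : QuadraticForm ℚ_[p] V), Q.Nondegenerate →
      (∃! g, LocalQuadratic.HasGHY Q g) ∧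
      (∃! s, LocalQuadratic.HasStd Q s) ∧
      ∀ g, LocalQuadratic.HasGHY Q g →
        LocalQuadratic.HasStd Q (LocalQuadratic.ghyToStd g) ∧
        ∀ m, LocalQuadratic.HasAnisoDim Q m ↔ m = LocalQuadratic.tableAnisoDim g) ∧
    Set.BijOn LocalQuadratic.ghyToStd
      (LocalQuadratic.ghyTriples.{u, 0} ℚ_[p]) (LocalQuadratic.stdTriples.{u, 0} ℚ_[p]) :=
  (LocalQuadratic.isHilbertField_padic p).ghy_std_comparison
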